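/- Let $a<b$, $\mu>0$, $\sigma>0$, $\lambda>0$, and let $\varphi:\mathbb R\to\mathbb R$ be a continuous, symmetric probability density whose support is contained in $(-J,J)$ for some $J>0$. Put $$\mathcal Lv(x)=-\tfrac12\sigma^2v''(x)+\mu x v'(x),\qquad \mathcal Iv(x)=\lambda\int_{-\infty}^{\infty}\big(v(x+y)-v(x)\big)\varphi(y)\,dy,$$ where functions $v\in L_2(a,b)$ are extended by zero outside $(a,b)$. Let $(\cdot,\cdot)$ and $\|\cdot\|$ be the scalar product and norm of $L_2(a,b)$, let $D$ denote the weak derivative, let $H^1_0(a,b)=\{v\in H^1(a,b):v(a)=v(b)=0\}$, and $$A(u,v)=\int_a^b\big(\tfrac12\sigma^2u'v'+\mu x u'v\big)\,dx-\int_a^b \mathcal Iu\;v\,dx .$$ Then the following hold. (1) For every $f\in L_2(a,b)$ the problem $(\mathcal L-\mathcal I)v=f$ in $(a,b)$, $v=0$ outside $(a,b)$, has a unique weak solution, i.e. there is a unique $v\in H^1_0(a,b)$ with $A(v,\phi)=(f,\phi)$ for all $\phi\in H^1_0(a,b)$. (2) This solution belongs to $H^2(a,b)$ and $\|D^2v\|\le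 c_3\|f\|$. (3) If $f(x)=-\mu x$, then the solution is classical: $v\in C^2([a,b])$, with the equation holding pointwise in $(a,b)$ and $v=0$ outside $(a,b)$. (4) For every $g\in L_2(a,b)$ the adjoint problem $-\tfrac12\sigma^2w''-\mu xw'-\mu w-\mathcal Iw=g$ in $(a,b)$, $w=0$ outside $(a,b)$, has a unique weak solution, i.e. there is a unique $w\in H^1_0(a,b)$ with $A(\phi,w)=(\phi,g)$ for all $\phi\in H^1_0(a,b)$; it belongs to $H^2(a,b)$ and $\|D^2w\|\le c_3\|g\|$. Here $c_3$ does not depend on $f$, $g$ or $\varphi$, and one may take $c_3=c_7+c_6c_8$ with $$\hat\gamma=\frac{\mu b}{\sigma^2}+\sqrt{\frac{\mu^2b^2}{\sigma^4}+\frac{2(\lambda+1)}{\sigma^2}},\quad c_2=\frac{b-a}{\pi},\quad c_4=e^{\hat\gamma(b-a)},\quad c_5=(b-a)c_4,$$ $$c_6=c_2\Big(\frac{2}{\sigma^2\mu}+\frac{4\mu^2}{\sigma^4}c_5^2\Big)^{1/2},\quad c_7=\frac4{\sigma^2},\quad c_8=\frac4{\sigma^2}\Big(2\lambda+\mu+\frac{\mu^2}{\sigma^2}\max(|a|,|b|)^2\Big).$$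 -/

import Mathlib

open MeasureTheory Set
open scoped ContDiff

noncomputable section

namespace OUJump

/-- The space `L_2(a,b)`. -/
abbrev L2 (a b : ℝ) : Type := Lp ℝ 2 (volume.restrict (Ioo a b))

/-- Smooth test functions with compact support in the open interval `(a,b)`. -/
def IsTestFunction (a b : ℝ) (ψ : ℝ → ℝ) : Prop :=
  ContDiff ℝ ∞ ψ ∧ HasCompactSupport ψ ∧ tsupport ψ ⊆ Ioo a b

/-- `d` is the weak derivative of `u` on `(a,b)`. -/
def IsWeakDeriv {a b : ℝ} (u d : L2 a b) : Prop :=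
  ∀ ψ : ℝ → ℝ, IsTestFunction a b ψ →
    ∫ x in Ioo a b, u x * deriv ψ x = -∫ x in Ioo a b, d x * ψ x

/-- The Sobolev space `H^1(a,b)`. -/
def MemH1 {a b : ℝ} (u : L2 a b) : Prop := ∃ d : L2 a b, IsWeakDeriv u d

open Classical in
/-- The weak derivative `Du ∈ L_2(a,b)` of `u ∈ H^1(a,b)` (and `0` if `u` is not in `H^1(a,b)`). -/
def D {a b : ℝ} (u : L2 a b) : L2 a b := if h : MemH1 u then h.choose else 0

/-- The Sobolev space `H^2(a,b)`. -/
def MemH2 {a b : ℝ} (u : L2 a b) : Prop := MemH1 u ∧ MemH1 (D u)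

/-- The space `H^1_0(a,b) = {v ∈ H^1(a,b) : v(a) = v(b) = 0}`, where the boundary values are those
of the representative of `v` that is continuous on `[a,b]`. -/
def MemH10 {a b : ℝ} (v : L2 a b) : Prop :=
  MemH1 v ∧ ∃ V : ℝ → ℝ, ContinuousOn V (Icc a b) ∧
    V =ᵐ[volume.restrict (Ioo a b)] v ∧ V a = 0 ∧ V b = 0

/-- Extension of `v ∈ L_2(a,b)` by zero outside `(a,b)`. -/
def zeroExt {a b : ℝ} (v : L2 a b) : ℝ → ℝ := (Ioo a b).indicator v

/-- A continuous symmetric probability density whose support lies in `(-J,J)` for some `J > 0`. -/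
structure IsJumpDensity (φ : ℝ → ℝ) : Prop where
  continuous : Continuous φ
  nonneg : ∀ y, 0 ≤ φ y
  symm : ∀ y, φ (-y) = φ y
  integral_eq_one : ∫ y, φ y = 1
  bounded_support : ∃ J : ℝ, 0 < J ∧ tsupport φ ⊆ Ioo (-J) J

/-- The differential operator `ℒ V(x) = -½ σ² V''(x) + μ x V'(x)`. -/
def opL (μ σ : ℝ) (V : ℝ → ℝ) (x : ℝ) : ℝ :=
  -(1 / 2) * σ ^ 2 * deriv (deriv V) x + μ * x * deriv V x

/-- The jump operator `ℐ V(x) = lam ∫ (V(x+y) - V(x)) φ(y) dy`. -/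
def opI (lam : ℝ) (φ : ℝ → ℝ) (V : ℝ → ℝ) (x : ℝ) : ℝ :=
  lam * ∫ y, (V (x + y) - V x) * φ y

/-- The bilinear form of `ℒ` on `H^1_0(a,b)`. -/
def formL {a b : ℝ} (μ σ : ℝ) (u v : L2 a b) : ℝ :=
  ∫ x in Ioo a b, ((1 / 2) * σ ^ 2 * D u x * D v x + μ * x * D u x * v x)

/-- The bilinear form of `ℐ` on `L_2(a,b)`. -/
def formI {a b : ℝ} (lam : ℝ) (φ : ℝ → ℝ) (u v : L2 a b) : ℝ :=
  ∫ x in Ioo a b, opI lam φ (zeroExt u) x * v x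

/-- The bilinear form `A(u,v)` of `ℒ - ℐ`. -/
def formA {a b : ℝ} (μ σ lam : ℝ) (φ : ℝ → ℝ) (u v : L2 a b) : ℝ :=
  formL μ σ u v - formI lam φ u v

/-- `v` is a weak solution of `ℒ v - ℐ v = f` in `(a,b)`, `v = 0` outside `(a,b)`. -/
def IsWeakSolution {a b : ℝ} (μ σ lam : ℝ) (φ : ℝ → ℝ) (f v : L2 a b) : Prop :=
  MemH10 v ∧ ∀ ψ : L2 a b, MemH10 ψ →
    formA μ σ lam φ v ψ = ∫ x in Ioo a b, f x * ψ x

/-- `w` is a weak solution of the adjoint problem `ℒ* w - ℐ w = g` in `(a,b)`, `w = 0` outside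
`(a,b)`, where `ℒ* w = -½ σ² w'' - μ x w' - μ w`. -/
def IsAdjointWeakSolution {a b : ℝ} (μ σ lam : ℝ) (φ : ℝ → ℝ) (g w : L2 a b) : Prop :=
  MemH10 w ∧ ∀ ψ : L2 a b, MemH10 ψ →
    formA μ σ lam φ ψ w = ∫ x in Ioo a b, ψ x * g x

/-- `V` is a classical solution of `ℒ V - ℐ V = f` in `(a,b)`, `V = 0` outside `(a,b)`:
it is `C²` on the closed interval `[a,b]` and the equation holds pointwise. -/
def IsClassicalSolution (a b μ σ lam : ℝ) (φ f V : ℝ → ℝ) : Prop :=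
  ContDiffOn ℝ 2 V (Icc a b) ∧
    (∀ x ∈ Ioo a b, opL μ σ V x - opI lam φ V x = f x) ∧
    ∀ x, x ∉ Ioo a b → V x = 0

/-- The positive root `γ` of `½ σ² γ² - μ b γ - lam = 1`. -/
def gammaHat (b μ σ lam : ℝ) : ℝ :=
  μ * b / σ ^ 2 + √(μ ^ 2 * b ^ 2 / σ ^ 4 + 2 * (lam + 1) / σ ^ 2)

def c2 (a b : ℝ) : ℝ := (b - a) / Real.pi

def c4 (a b μ σ lam : ℝ) : ℝ := Real.exp (gammaHat b μ σ lam * (b - a))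

def c5 (a b μ σ lam : ℝ) : ℝ := (b - a) * c4 a b μ σ lam

def c6 (a b μ σ lam : ℝ) : ℝ :=
  c2 a b * √(2 / (σ ^ 2 * μ) + 4 * μ ^ 2 / σ ^ 4 * c5 a b μ σ lam ^ 2)

def c7 (σ : ℝ) : ℝ := 4 / σ ^ 2

def c8 (a b μ σ lam : ℝ) : ℝ :=
  4 / σ ^ 2 * (2 * lam + μ + μ ^ 2 / σ ^ 2 * max |a| |b| ^ 2)

/-- The constant in the `H^2` bounds; it depends on `a, b, μ, σ, lam` only, not on the density. -/
def c3 (a b μ σ lam : ℝ) : ℝ := c7 σ + c6 a b μ σ lam * c8 a b μ σ lam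

end OUJump

end

open OUJump

/-!
Write `H = L_2(a,b)`. A function lies in `H^1_0(a,b)` exactly when it is the primitive `volt p` of
some `p ∈ H` with vanishing integral, and then `p` is its weak derivative. On this space the form is
`½σ²(Du, Dv) + μ(x Du, v) - lam(Φu - u, v)`, where the jump average `Φ` is symmetric and of norm at
most `1` (`formA_eq`, `inner_avgOp`, `norm_avgOp_le`). Since `(x Dv, v) = -½‖v‖²`, the form satisfies
Gårding's inequality with the bad term `-½μ‖v‖²`, so it need not be coercive.

The missing control comes from the maximum principle. All estimates are made for the problem shifted
by `t ≥ 0`, that is for `ℒ - ℐ + t`, uniformly in `t`.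

* A solution with continuous right-hand side `F` is `C²` up to the boundary, so a comparison with the
  barrier `m (c₄ - exp (γ (x - a)))` at an interior maximum gives `|v| ≤ c₄ sup |F|`
  (`IsShiftedSolution.ae_abs_le`). The root `γ` is chosen so that the barrier is a strict
  supersolution in spite of the jumps.
* For an adjoint solution `w` with data `g`, let `v` solve the primal problem with the continuous
  data `w`. Then `‖w‖² = (v, g)`, and `|w| ≤ √(b-a) ‖Dw‖` yields `‖w‖² ≤ c₅ ‖Dw‖ ‖g‖`. With Gårding's
  inequality and the sharp Poincaré inequality this becomes `‖w‖ ≤ c₆ ‖g‖`, and duality carries the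
  bound over to the primal problem.
* For the shift `t = μ` the form is coercive and the Lax–Milgram theorem applies. As the solution
  operators are bounded by `c₆` for every `t ≥ 0`, the shift can be lowered to `0` in finitely many
  equal steps, each a contraction argument (`isSolvable_zero`). Uniqueness for each problem follows
  from solvability of the other one.

The equation expresses `D²v` through `Dv`, `v` and the data. The first order term is absorbed through
`‖Dv‖² = -(v, D²v)`, which gives the `H²` bound with the constant `c₃ = c₇ + c₆ c₈`.
-/

namespace OUJump

open scoped InnerProductSpace

variable {a b μ σ lam t : ℝ} {φ : ℝ → ℝ}

/-! ### Integrals of functions in `L_2(a,b)` -/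

lemma integrable_coe (u : L2 a b) : Integrable u (volume.restrict (Ioo a b)) :=
  (Lp.memLp u).integrable one_le_two

lemma integrable_coe_mul (u v : L2 a b) :
    Integrable (fun x => u x * v x) (volume.restrict (Ioo a b)) := by
  have h := L2.integrable_inner (𝕜 := ℝ) v u
  simpa using! h

lemma inner_eq_integral (u v : L2 a b) : ⟪u, v⟫_ℝ = ∫ x in Ioo a b, u x * v x := by
  rw [L2.inner_def]
  refine integral_congr_ae (Filter.Eventually.of_forall fun x => ?_)
  simp [mul_comm]

/-- The constant function `1` as an element of `L_2(a,b)`. -/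
noncomputable def one (a b : ℝ) : L2 a b := (memLp_const (1 : ℝ)).toLp (fun _ => (1 : ℝ))

lemma coe_one : one a b =ᵐ[volume.restrict (Ioo a b)] fun _ => (1 : ℝ) := MemLp.coeFn_toLp _

lemma inner_one (u : L2 a b) : ⟪one a b, u⟫_ℝ = ∫ x in Ioo a b, u x := by
  rw [inner_eq_integral]
  refine integral_congr_ae ?_
  filter_upwards [coe_one] with x hx
  simp [hx]

lemma norm_one_sq (hab : a ≤ b) : ‖one a b‖ ^ 2 = b - a := by
  rw [← real_inner_self_eq_norm_sq, inner_one, integral_congr_ae coe_one]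
  simp [hab]

lemma norm_le_of_ae_bound {u : L2 a b} {C : ℝ}
    (h : ∀ᵐ x ∂volume.restrict (Ioo a b), |u x| ≤ C) : ‖u‖ ≤ C * ‖one a b‖ := by
  refine Lp.norm_le_mul_norm_of_ae_le_mul ?_
  filter_upwards [h, coe_one] with x hx h1
  simpa [h1] using hx

lemma integral_abs_le (u : L2 a b) : ∫ x in Ioo a b, |u x| ≤ ‖one a b‖ * ‖u‖ := by
  have h : ∫ x in Ioo a b, |u x| = ⟪one a b, |u|⟫_ℝ := by
    rw [inner_one]
    exact integral_congr_ae (Lp.coeFn_abs u).symm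
  rw [h, ← norm_abs_eq_norm u]
  exact real_inner_le_norm _ _

lemma zeroExt_ae_eq (u : L2 a b) : zeroExt u =ᵐ[volume.restrict (Ioo a b)] u :=
  indicator_ae_eq_restrict measurableSet_Ioo

lemma integrable_zeroExt (u : L2 a b) : Integrable (zeroExt u) :=
  (integrable_indicator_iff measurableSet_Ioo).2 (integrable_coe u)

/-- Two functions that vanish outside `(a,b)` agree almost everywhere on the line as soon as they
do so in `(a,b)`. -/
lemma ae_eq_of_restrict {f g : ℝ → ℝ} (h : f =ᵐ[volume.restrict (Ioo a b)] g)
    (hf : ∀ x, x ∉ Ioo a b → f x = 0) (hg : ∀ x, x ∉ Ioo a b → g x = 0) : f =ᵐ[volume] g := by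
  filter_upwards [(ae_restrict_iff' measurableSet_Ioo).1 h] with x hx
  by_cases hx' : x ∈ Ioo a b
  · exact hx hx'
  · rw [hf x hx', hg x hx']

lemma zeroExt_of_notMem (u : L2 a b) {x : ℝ} (hx : x ∉ Ioo a b) : zeroExt u x = 0 :=
  indicator_of_notMem hx _

lemma zeroExt_add (u v : L2 a b) : zeroExt (u + v) =ᵐ[volume] zeroExt u + zeroExt v := by
  refine ae_eq_of_restrict (a := a) (b := b) ?_ (fun x hx => zeroExt_of_notMem _ hx) fun x hx => ?_
  · filter_upwards [zeroExt_ae_eq (u + v), zeroExt_ae_eq u, zeroExt_ae_eq v, Lp.coeFn_add u v]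
      with x h1 h2 h3 h4
    rw [Pi.add_apply, h1, h2, h3]
    exact h4
  · simp [zeroExt_of_notMem _ hx]

lemma zeroExt_smul (c : ℝ) (u : L2 a b) : zeroExt (c • u) =ᵐ[volume] c • zeroExt u := by
  refine ae_eq_of_restrict (a := a) (b := b) ?_ (fun x hx => zeroExt_of_notMem _ hx) fun x hx => ?_
  · filter_upwards [zeroExt_ae_eq (c • u), zeroExt_ae_eq u, Lp.coeFn_smul c u]
      with x h1 h2 h3
    rw [Pi.smul_apply, h1, h2]
    exact h3
  · simp [zeroExt_of_notMem _ hx]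

/-! ### Primitives and the Volterra operator -/

/-- The primitive `x ↦ ∫_a^x u` of `u ∈ L_2(a,b)`, defined on the whole line through the extension
of `u` by zero. -/
noncomputable def prim (u : L2 a b) (x : ℝ) : ℝ := ∫ t in a..x, zeroExt u t

lemma continuous_prim (u : L2 a b) : Continuous (prim u) :=
  intervalIntegral.continuous_primitive (fun _ _ => (integrable_zeroExt u).intervalIntegrable) a

@[simp] lemma prim_left (u : L2 a b) : prim u a = 0 := intervalIntegral.integral_same

lemma ae_hasDerivAt_prim (u : L2 a b) : ∀ᵐ x, HasDerivAt (prim u) (zeroExt u x) x := by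
  filter_upwards [LocallyIntegrable.ae_hasDerivAt_integral
    (integrable_zeroExt u).locallyIntegrable] with x hx
  exact hx a

lemma ac_prim (u : L2 a b) : AbsolutelyContinuousOnInterval (prim u) a b :=
  (integrable_zeroExt u).intervalIntegrable.absolutelyContinuousOnInterval_intervalIntegral
    left_mem_uIcc

lemma abs_prim_le (u : L2 a b) (x : ℝ) : |prim u x| ≤ ‖one a b‖ * ‖u‖ := by
  refine le_trans ?_ (integral_abs_le u)
  have h : ∫ x in Ioo a b, |u x| = ∫ x, |zeroExt u x| := by
    rw [← integral_indicator measurableSet_Ioo]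
    congr 1
    ext x
    by_cases hx : x ∈ Ioo a b <;> simp [zeroExt, hx]
  rw [h, ← Real.norm_eq_abs, prim]
  refine (intervalIntegral.norm_integral_le_integral_norm_uIoc).trans ?_
  exact setIntegral_le_integral (integrable_zeroExt u).norm
    (Filter.Eventually.of_forall fun _ => norm_nonneg _)

lemma prim_add (u v : L2 a b) (x : ℝ) : prim (u + v) x = prim u x + prim v x := by
  rw [prim, prim, prim, ← intervalIntegral.integral_add
    (integrable_zeroExt u).intervalIntegrable (integrable_zeroExt v).intervalIntegrable]
  refine intervalIntegral.integral_congr_ae ?_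
  filter_upwards [zeroExt_add u v] with t ht _
  exact ht

lemma prim_smul (c : ℝ) (u : L2 a b) (x : ℝ) : prim (c • u) x = c * prim u x := by
  rw [prim, prim, ← intervalIntegral.integral_const_mul]
  refine intervalIntegral.integral_congr_ae ?_
  filter_upwards [zeroExt_smul c u] with t ht _
  exact ht

lemma memLp_of_continuous {f : ℝ → ℝ} (hf : Continuous f) :
    MemLp f 2 (volume.restrict (Ioo a b)) := by
  obtain ⟨C, hC⟩ := isCompact_Icc.exists_bound_of_continuousOn (s := Icc a b) hf.continuousOn
  refine MemLp.of_bound hf.aestronglyMeasurable C ?_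
  filter_upwards [ae_restrict_mem measurableSet_Ioo] with x hx
  exact hC x (Ioo_subset_Icc_self hx)

/-- The Volterra operator `u ↦ ∫_a^x u` on `L_2(a,b)`. -/
noncomputable def volt : L2 a b →L[ℝ] L2 a b :=
  LinearMap.mkContinuous
    { toFun := fun u => (memLp_of_continuous (continuous_prim u)).toLp (prim u)
      map_add' := fun u v => by
        rw [← MemLp.toLp_add]
        exact MemLp.toLp_congr _ _ (Filter.Eventually.of_forall fun x => prim_add u v x)
      map_smul' := fun c u => by
        rw [RingHom.id_apply, ← MemLp.toLp_const_smul]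
        exact MemLp.toLp_congr _ _ (Filter.Eventually.of_forall fun x => prim_smul c u x) }
    (‖one a b‖ * ‖one a b‖) fun u => by
      refine (norm_le_of_ae_bound (C := ‖one a b‖ * ‖u‖) ?_).trans (le_of_eq (by ring))
      filter_upwards [(memLp_of_continuous (continuous_prim u)).coeFn_toLp] with x hx
      rw [LinearMap.coe_mk, AddHom.coe_mk, hx]
      exact abs_prim_le u x

lemma coe_volt (u : L2 a b) : volt u =ᵐ[volume.restrict (Ioo a b)] prim u :=
  (memLp_of_continuous (continuous_prim u)).coeFn_toLp

lemma eq_volt_of_ae {u v : L2 a b} (h : v =ᵐ[volume.restrict (Ioo a b)] prim u) : v = volt u :=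
  Lp.ext (h.trans (coe_volt u).symm)

/-- An integral over `(a,b)` as an interval integral. -/
lemma setIntegral_eq_of_ae (hab : a ≤ b) {f g : ℝ → ℝ}
    (h : f =ᵐ[volume.restrict (Ioo a b)] g) : ∫ x in Ioo a b, f x = ∫ x in a..b, g x := by
  rw [integral_congr_ae h, intervalIntegral.integral_of_le hab, integral_Ioc_eq_integral_Ioo]

/-- Fundamental theorem of calculus on `(a,b)` for absolutely continuous functions, with an
almost everywhere derivative. -/
lemma integral_eq_sub_of_ac (hab : a ≤ b) {f f' : ℝ → ℝ}
    (hf : AbsolutelyContinuousOnInterval f a b)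
    (hf' : ∀ᵐ x ∂volume.restrict (Ioo a b), HasDerivAt f (f' x) x) :
    ∫ x in Ioo a b, f' x = f b - f a := by
  rw [← hf.integral_deriv_eq_sub]
  refine setIntegral_eq_of_ae hab ?_
  filter_upwards [hf'] with x hx
  exact hx.deriv.symm

lemma prim_right (hab : a ≤ b) (u : L2 a b) : prim u b = ∫ x in Ioo a b, u x :=
  (setIntegral_eq_of_ae hab (zeroExt_ae_eq u).symm).symm

lemma inner_one_eq_prim (hab : a ≤ b) (u : L2 a b) : ⟪one a b, u⟫_ℝ = prim u b := by
  rw [inner_one, prim_right hab]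

lemma ae_hasDerivAt_prim_restrict (u : L2 a b) :
    ∀ᵐ x ∂volume.restrict (Ioo a b), HasDerivAt (prim u) (u x) x := by
  filter_upwards [ae_restrict_of_ae (ae_hasDerivAt_prim u), zeroExt_ae_eq u] with x hx h
  rwa [h] at hx

/-- Integration by parts for two primitives. -/
lemma integral_mul_prim (hab : a ≤ b) (p q : L2 a b) :
    ∫ x in Ioo a b, (p x * prim q x + prim p x * q x) = prim p b * prim q b := by
  rw [integral_eq_sub_of_ac hab ((ac_prim p).fun_mul (ac_prim q))]
  · simp
  · filter_upwards [ae_hasDerivAt_prim_restrict p, ae_hasDerivAt_prim_restrict q] with x hp hq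
    exact hp.mul hq

lemma inner_volt_add_inner_volt (hab : a ≤ b) (p q : L2 a b) :
    ⟪p, volt q⟫_ℝ + ⟪volt p, q⟫_ℝ = prim p b * prim q b := by
  rw [← integral_mul_prim hab, inner_eq_integral, inner_eq_integral,
    ← integral_add (integrable_coe_mul _ _) (integrable_coe_mul _ _)]
  refine integral_congr_ae ?_
  filter_upwards [coe_volt p, coe_volt q] with x hp hq
  rw [hp, hq]

/-! ### Weak derivatives and the fundamental lemma -/

lemma IsTestFunction.eq_zero {ψ : ℝ → ℝ} (hψ : IsTestFunction a b ψ) {x : ℝ} (hx : x ∉ Ioo a b) :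
    ψ x = 0 :=
  image_eq_zero_of_notMem_tsupport fun h => hx (hψ.2.2 h)

lemma IsTestFunction.differentiable {ψ : ℝ → ℝ} (hψ : IsTestFunction a b ψ) :
    Differentiable ℝ ψ := hψ.1.differentiable (by simp)

lemma IsTestFunction.continuous_deriv {ψ : ℝ → ℝ} (hψ : IsTestFunction a b ψ) :
    Continuous (deriv ψ) := hψ.1.continuous_deriv (by simp)

/-- An element of `L_2(a,b)` is integrable against a continuous function. -/
lemma integrable_mul_continuous (u : L2 a b) {f : ℝ → ℝ} (hf : Continuous f) :
    Integrable (fun x => u x * f x) (volume.restrict (Ioo a b)) :=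
  (Lp.memLp u).integrable_mul (memLp_of_continuous hf)

/-- The primitives are weakly differentiable, with the expected weak derivative. -/
lemma isWeakDeriv_of_ae (hab : a ≤ b) {u d : L2 a b} {c : ℝ}
    (h : u =ᵐ[volume.restrict (Ioo a b)] fun x => c + prim d x) : IsWeakDeriv u d := by
  intro ψ hψ
  have hac : AbsolutelyContinuousOnInterval ψ a b :=
    (hψ.1.of_le (by simp)).contDiffOn.absolutelyContinuousOnInterval
  have hc : AbsolutelyContinuousOnInterval (fun _ : ℝ => c) a b :=
    contDiff_const.contDiffOn.absolutelyContinuousOnInterval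
  have key := integral_eq_sub_of_ac (f' := fun x => d x * ψ x + (c + prim d x) * deriv ψ x) hab
    ((hc.fun_add (ac_prim d)).fun_mul hac) (by
      filter_upwards [ae_hasDerivAt_prim_restrict d] with x hx
      exact (hx.const_add c).mul (hψ.differentiable x).hasDerivAt)
  have hint : Integrable (fun x => (c + prim d x) * deriv ψ x) (volume.restrict (Ioo a b)) :=
    (memLp_of_continuous ((continuous_const.add (continuous_prim d)).mul
      hψ.continuous_deriv)).integrable one_le_two
  rw [integral_add (integrable_mul_continuous d hψ.1.continuous) hint, hψ.eq_zero (x := a) (by simp),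
    hψ.eq_zero (x := b) (by simp)] at key
  have h2 : ∫ x in Ioo a b, u x * deriv ψ x = ∫ x in Ioo a b, (c + prim d x) * deriv ψ x := by
    refine integral_congr_ae ?_
    filter_upwards [h] with x hx
    rw [hx]
  rw [h2]
  linarith

/-- The fundamental lemma of the calculus of variations. -/
lemma ae_eq_zero_of_forall_integral_mul_test {f : ℝ → ℝ}
    (hf : Integrable f (volume.restrict (Ioo a b)))
    (h : ∀ ψ, IsTestFunction a b ψ → ∫ x in Ioo a b, f x * ψ x = 0) :
    f =ᵐ[volume.restrict (Ioo a b)] 0 := by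
  refine (ae_restrict_iff' measurableSet_Ioo).2
    (isOpen_Ioo.ae_eq_zero_of_integral_contDiff_smul_eq_zero
      (IntegrableOn.locallyIntegrableOn hf) fun g hg hgc hgs => ?_)
  rw [← h g ⟨hg, hgc, hgs⟩, ← integral_indicator measurableSet_Ioo]
  congr 1
  ext x
  by_cases hx : x ∈ Ioo a b
  · simp [hx, mul_comm]
  · simp [hx, image_eq_zero_of_notMem_tsupport fun h => hx (hgs h)]

lemma IsWeakDeriv.unique {u d e : L2 a b} (hd : IsWeakDeriv u d) (he : IsWeakDeriv u e) :
    d = e := by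
  rw [← sub_eq_zero]
  refine Lp.ext ((ae_eq_zero_of_forall_integral_mul_test (integrable_coe _) fun ψ hψ => ?_).trans
    (Lp.coeFn_zero ..).symm)
  have h : ∫ x in Ioo a b, (d - e) x * ψ x = ∫ x in Ioo a b, (d x * ψ x - e x * ψ x) := by
    refine integral_congr_ae ?_
    filter_upwards [Lp.coeFn_sub d e] with x hx
    rw [hx, Pi.sub_apply, sub_mul]
  rw [h, integral_sub (integrable_mul_continuous d hψ.1.continuous)
    (integrable_mul_continuous e hψ.1.continuous)]
  linarith [hd ψ hψ, he ψ hψ]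

lemma D_eq {u d : L2 a b} (h : IsWeakDeriv u d) : D u = d := by
  have hu : MemH1 u := ⟨d, h⟩
  rw [D, dif_pos hu]
  exact hu.choose_spec.unique h

lemma MemH1.isWeakDeriv {u : L2 a b} (h : MemH1 u) : IsWeakDeriv u (D u) := by
  obtain ⟨d, hd⟩ := h
  rwa [D_eq hd]

/-- A smooth function with compact support in `(a,b)` and vanishing integral is the derivative of a
test function. -/
lemma IsTestFunction.exists_deriv_eq {χ : ℝ → ℝ} (hχ : IsTestFunction a b χ)
    (h0 : ∫ x in Ioo a b, χ x = 0) (hab : a < b) :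
    ∃ ψ, IsTestFunction a b ψ ∧ deriv ψ = χ := by
  have hcont := hχ.1.continuous
  -- the support lies in a compact interval `[l, r] ⊆ (a, b)`
  obtain ⟨l, r, hl, hr, hlr, hsupp⟩ : ∃ l r, a < l ∧ r < b ∧ l ≤ r ∧ tsupport χ ⊆ Icc l r := by
    have hK : IsCompact (insert ((a + b) / 2) (tsupport χ)) := hχ.2.1.insert _
    have hne : (insert ((a + b) / 2) (tsupport χ)).Nonempty := insert_nonempty _ _
    have hsub : insert ((a + b) / 2) (tsupport χ) ⊆ Ioo a b :=
      insert_subset ⟨by linarith, by linarith⟩ hχ.2.2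
    obtain ⟨l, hl⟩ := hK.exists_isLeast hne
    obtain ⟨r, hr⟩ := hK.exists_isGreatest hne
    exact ⟨l, r, (hsub hl.1).1, (hsub hr.1).2, hl.2 hr.1,
      fun x hx => ⟨hl.2 (mem_insert_of_mem _ hx), hr.2 (mem_insert_of_mem _ hx)⟩⟩
  have hder : ∀ x, HasDerivAt (fun x => ∫ t in a..x, χ t) (χ x) x := fun x =>
    intervalIntegral.integral_hasDerivAt_right (hcont.intervalIntegrable _ _)
      hcont.aestronglyMeasurable.stronglyMeasurableAtFilter hcont.continuousAt
  have hderiv : deriv (fun x => ∫ t in a..x, χ t) = χ := funext fun x => (hder x).deriv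
  have hz : ∀ x, x ∉ Icc l r → ∫ t in a..x, χ t = 0 := by
    intro x hx
    rcases lt_or_ge x l with h | h
    · refine (intervalIntegral.integral_congr (g := fun _ => (0 : ℝ)) fun t ht => ?_).trans (by simp)
      refine image_eq_zero_of_notMem_tsupport fun htt => ?_
      have h1 := (hsupp htt).1
      have h2 : t ≤ max a x := ht.2
      rcases max_choice a x with h3 | h3 <;> rw [h3] at h2 <;> linarith
    · have hxr : r < x := lt_of_not_ge fun h' => hx ⟨h, h'⟩
      rw [← intervalIntegral.integral_add_adjacent_intervals (hcont.intervalIntegrable a b)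
        (hcont.intervalIntegrable b x)]
      have h1 : ∫ t in a..b, χ t = 0 := by
        rw [← h0]; exact (setIntegral_eq_of_ae hab.le Filter.EventuallyEq.rfl).symm
      rw [h1, zero_add]
      refine (intervalIntegral.integral_congr (g := fun _ => (0 : ℝ)) fun t ht => ?_).trans (by simp)
      refine image_eq_zero_of_notMem_tsupport fun htt => ?_
      have h1 := (hsupp htt).2
      have h2 : min b x ≤ t := ht.1
      rcases min_choice b x with h3 | h3 <;> rw [h3] at h2 <;> linarith
  refine ⟨fun x => ∫ t in a..x, χ t, ⟨?_, ?_, ?_⟩, hderiv⟩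
  · rw [contDiff_infty_iff_deriv, hderiv]
    exact ⟨fun x => (hder x).differentiableAt, hχ.1⟩
  · exact HasCompactSupport.intro isCompact_Icc hz
  · refine (closure_minimal (fun x hx => ?_) isClosed_Icc).trans (Icc_subset_Ioo hl hr)
    by_contra h
    exact hx (hz x h)

/-- The lemma of du Bois-Reymond: a function with vanishing weak derivative is constant. -/
lemma ae_eq_const_of_forall_integral_mul_deriv_test (hab : a < b) {f : ℝ → ℝ}
    (hf : MemLp f 2 (volume.restrict (Ioo a b)))
    (h : ∀ ψ, IsTestFunction a b ψ → ∫ x in Ioo a b, f x * deriv ψ x = 0) :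
    ∃ c : ℝ, f =ᵐ[volume.restrict (Ioo a b)] fun _ => c := by
  let B : ContDiffBump ((a + b) / 2) := ⟨(b - a) / 8, (b - a) / 4, by linarith, by linarith⟩
  obtain ⟨ρ, hρ, hρ1⟩ : ∃ ρ, IsTestFunction a b ρ ∧ ∫ x in Ioo a b, ρ x = 1 := by
    have hts : tsupport (B.normed volume) ⊆ Ioo a b := by
      rw [B.tsupport_normed_eq, Real.closedBall_eq_Icc]
      refine Icc_subset_Ioo ?_ ?_ <;> simp only [B] <;> linarith
    refine ⟨B.normed volume, ⟨B.contDiff_normed, B.hasCompactSupport_normed, hts⟩, ?_⟩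
    rw [setIntegral_eq_integral_of_forall_compl_eq_zero, B.integral_normed]
    exact fun x hx => image_eq_zero_of_notMem_tsupport fun h => hx (hts h)
  have hmul : ∀ {g : ℝ → ℝ}, Continuous g →
      Integrable (fun x => f x * g x) (volume.restrict (Ioo a b)) :=
    fun hg => hf.integrable_mul (memLp_of_continuous hg)
  have hint : ∀ {g : ℝ → ℝ}, Continuous g → Integrable g (volume.restrict (Ioo a b)) :=
    fun hg => (memLp_of_continuous hg).integrable one_le_two
  refine ⟨∫ x in Ioo a b, f x * ρ x, ?_⟩
  have key := ae_eq_zero_of_forall_integral_mul_test (a := a) (b := b)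
    (f := fun x => f x - ∫ x in Ioo a b, f x * ρ x)
    ((hf.integrable one_le_two).sub (integrable_const _)) fun χ hχ => ?_
  · filter_upwards [key] with x hx
    exact sub_eq_zero.1 hx
  · have hχ' : IsTestFunction a b fun x => χ x - (∫ x in Ioo a b, χ x) * ρ x := by
      refine ⟨hχ.1.sub (contDiff_const.mul hρ.1), hχ.2.1.sub hρ.2.1.mul_left, ?_⟩
      refine (tsupport_sub _ _).trans (union_subset hχ.2.2 ?_)
      exact (tsupport_mul_subset_right).trans hρ.2.2
    obtain ⟨ψ, hψ, hψ'⟩ := hχ'.exists_deriv_eq (by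
      rw [integral_sub (hint hχ.1.continuous) ((hint hρ.1.continuous).const_mul _),
        integral_const_mul, hρ1]; ring) hab
    have h1 := h ψ hψ
    rw [hψ'] at h1
    have h2 : ∀ x, f x * (χ x - (∫ x in Ioo a b, χ x) * ρ x)
        = f x * χ x - (∫ x in Ioo a b, χ x) * (f x * ρ x) := fun x => by ring
    simp only [h2] at h1
    rw [integral_sub (hmul hχ.1.continuous) ((hmul hρ.1.continuous).const_mul _),
      integral_const_mul] at h1
    simp only [sub_mul]
    rw [integral_sub (hmul hχ.1.continuous) ((hint hχ.1.continuous).const_mul _),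
      integral_const_mul]
    linarith

/-- A function in `H^1(a,b)` is a constant plus the primitive of its weak derivative. -/
lemma IsWeakDeriv.exists_ae_eq (hab : a < b) {u d : L2 a b} (h : IsWeakDeriv u d) :
    ∃ c : ℝ, u =ᵐ[volume.restrict (Ioo a b)] fun x => c + prim d x := by
  have hd : IsWeakDeriv (volt d) d :=
    isWeakDeriv_of_ae hab.le (c := 0) (by simpa using coe_volt d)
  obtain ⟨c, hc⟩ := ae_eq_const_of_forall_integral_mul_deriv_test hab
    (f := fun x => u x - volt d x) ((Lp.memLp u).sub (Lp.memLp _)) fun ψ hψ => by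
      simp only [sub_mul]
      rw [integral_sub (integrable_mul_continuous _ hψ.continuous_deriv)
        (integrable_mul_continuous _ hψ.continuous_deriv), h ψ hψ, hd ψ hψ, sub_self]
  refine ⟨c, ?_⟩
  filter_upwards [hc, coe_volt d] with x hx hv
  rw [← hv, ← hx]; ring

/-- Functions continuous on `[a,b]` that agree almost everywhere agree everywhere. -/
lemma eqOn_Icc_of_ae_eq (hab : a < b) {f g : ℝ → ℝ} (hf : ContinuousOn f (Icc a b))
    (hg : ContinuousOn g (Icc a b)) (h : f =ᵐ[volume.restrict (Ioo a b)] g) :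
    EqOn f g (Icc a b) := by
  have h1 : EqOn f g (Ioo a b) :=
    Measure.eqOn_open_of_ae_eq h isOpen_Ioo (hf.mono Ioo_subset_Icc_self)
      (hg.mono Ioo_subset_Icc_self)
  exact h1.of_subset_closure hf hg Ioo_subset_Icc_self (closure_Ioo hab.ne).ge

/-! ### The space `H^1_0(a,b)` as a space of primitives -/

lemma memH10_volt (hab : a ≤ b) {p : L2 a b} (hp : prim p b = 0) : MemH10 (volt p) :=
  ⟨⟨p, isWeakDeriv_of_ae hab (c := 0) (by simpa using coe_volt p)⟩, prim p,
    (continuous_prim p).continuousOn, (coe_volt p).symm, prim_left p, hp⟩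

lemma D_volt (hab : a ≤ b) (p : L2 a b) : D (volt p) = p :=
  D_eq (isWeakDeriv_of_ae hab (c := 0) (by simpa using coe_volt p))

lemma MemH10.prim_D_and_eq (hab : a < b) {v : L2 a b} (hv : MemH10 v) :
    prim (D v) b = 0 ∧ v = volt (D v) := by
  obtain ⟨c, hc⟩ := hv.1.isWeakDeriv.exists_ae_eq hab
  obtain ⟨-, V, hVc, hV, hVa, hVb⟩ := hv
  have h := eqOn_Icc_of_ae_eq hab hVc
    (continuous_const.add (continuous_prim (D v))).continuousOn (hV.trans hc)
  have h1 := h (left_mem_Icc.2 hab.le)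
  have h2 := h (right_mem_Icc.2 hab.le)
  simp only [hVa, hVb, Pi.add_apply, prim_left, add_zero] at h1 h2
  subst h1
  exact ⟨by linarith, eq_volt_of_ae (by simpa using hc)⟩

/-! ### The jump operator -/

lemma integrable_zeroExt_sq (u : L2 a b) : Integrable (fun x => zeroExt u x ^ 2) := by
  have h : (fun x => zeroExt u x ^ 2) = (Ioo a b).indicator (fun x => u x * u x) := by
    ext x
    by_cases hx : x ∈ Ioo a b <;> simp [zeroExt, hx, sq]
  rw [h]
  exact (integrable_indicator_iff measurableSet_Ioo).2 (integrable_coe_mul u u)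

lemma integral_zeroExt_sq (u : L2 a b) : ∫ x, zeroExt u x ^ 2 = ‖u‖ ^ 2 := by
  rw [← real_inner_self_eq_norm_sq, inner_eq_integral, ← integral_indicator measurableSet_Ioo]
  congr 1
  ext x
  by_cases hx : x ∈ Ioo a b <;> simp [zeroExt, hx, sq]

lemma inner_eq_integral_zeroExt_mul (u v : L2 a b) {f : ℝ → ℝ}
    (h : u =ᵐ[volume.restrict (Ioo a b)] f) : ⟪u, v⟫_ℝ = ∫ x, f x * zeroExt v x := by
  have h0 : ∫ x in Ioo a b, f x * zeroExt v x = ∫ x, f x * zeroExt v x :=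
    setIntegral_eq_integral_of_forall_compl_eq_zero
      fun x hx => by rw [zeroExt_of_notMem v hx, mul_zero]
  rw [inner_eq_integral, ← h0]
  refine integral_congr_ae ?_
  filter_upwards [h, zeroExt_ae_eq v] with x hx hv
  rw [hx, hv]

/-! ### Multiplication by the coordinate -/

lemma memLp_mulX (u : L2 a b) : MemLp (fun x => x * u x) 2 (volume.restrict (Ioo a b)) := by
  refine (Lp.memLp u).of_le_mul (c := max |a| |b|)
    (aestronglyMeasurable_id.mul (Lp.aestronglyMeasurable u)) ?_
  filter_upwards [ae_restrict_mem measurableSet_Ioo] with x hx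
  rw [norm_mul]
  exact mul_le_mul_of_nonneg_right (abs_le_max_abs_abs hx.1.le hx.2.le) (norm_nonneg _)

/-- Multiplication by the coordinate function `x`. -/
noncomputable def mulX : L2 a b →L[ℝ] L2 a b :=
  LinearMap.mkContinuous
    { toFun := fun u => (memLp_mulX u).toLp _
      map_add' := fun u v => by
        rw [← MemLp.toLp_add]
        refine MemLp.toLp_congr _ _ ?_
        filter_upwards [Lp.coeFn_add u v] with x hx
        simp only [Pi.add_apply, hx, mul_add]
      map_smul' := fun c u => by
        rw [RingHom.id_apply, ← MemLp.toLp_const_smul]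
        refine MemLp.toLp_congr _ _ ?_
        filter_upwards [Lp.coeFn_smul c u] with x hx
        simp only [Pi.smul_apply, hx, smul_eq_mul, mul_left_comm] }
    (max |a| |b|) fun u => by
      refine Lp.norm_le_mul_norm_of_ae_le_mul ?_
      filter_upwards [(memLp_mulX u).coeFn_toLp, ae_restrict_mem measurableSet_Ioo] with x hx hx'
      rw [LinearMap.coe_mk, AddHom.coe_mk, hx, norm_mul]
      exact mul_le_mul_of_nonneg_right (abs_le_max_abs_abs hx'.1.le hx'.2.le) (norm_nonneg _)

lemma coe_mulX (u : L2 a b) : mulX u =ᵐ[volume.restrict (Ioo a b)] fun x => x * u x :=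
  (memLp_mulX u).coeFn_toLp

lemma norm_mulX_le (u : L2 a b) : ‖mulX u‖ ≤ max |a| |b| * ‖u‖ := by
  refine Lp.norm_le_mul_norm_of_ae_le_mul ?_
  filter_upwards [coe_mulX u, ae_restrict_mem measurableSet_Ioo] with x hx hx'
  rw [hx, norm_mul]
  exact mul_le_mul_of_nonneg_right (abs_le_max_abs_abs hx'.1.le hx'.2.le) (norm_nonneg _)

lemma inner_mulX (u v : L2 a b) : ⟪mulX u, v⟫_ℝ = ⟪u, mulX v⟫_ℝ := by
  rw [inner_eq_integral, inner_eq_integral]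
  refine integral_congr_ae ?_
  filter_upwards [coe_mulX u, coe_mulX v] with x hu hv
  rw [hu, hv]; ring

lemma IsJumpDensity.integrable (hφ : IsJumpDensity φ) : Integrable φ :=
  integrable_of_integral_eq_one hφ.integral_eq_one

lemma IsJumpDensity.exists_bound (hφ : IsJumpDensity φ) : ∃ C, ∀ y, |φ y| ≤ C := by
  obtain ⟨J, -, hJ⟩ := hφ.bounded_support
  have hc : HasCompactSupport φ :=
    isCompact_Icc.of_isClosed_subset (isClosed_tsupport φ) (hJ.trans Ioo_subset_Icc_self)
  exact hc.exists_bound_of_continuous hφ.continuous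

/-- The average `x ↦ ∫ u(z) φ(x - z) dz` of the extension by zero of `u` after a jump; by the
symmetry of `φ` it is `∫ u(x + y) φ(y) dy`. -/
noncomputable def avg (φ : ℝ → ℝ) (u : L2 a b) (x : ℝ) : ℝ := ∫ z, zeroExt u z * φ (x - z)

lemma IsJumpDensity.integrable_mul (hφ : IsJumpDensity φ) {f : ℝ → ℝ} (hf : Integrable f) (x : ℝ) :
    Integrable (fun z => f z * φ (x - z)) := by
  obtain ⟨C, hC⟩ := hφ.exists_bound
  exact hf.mul_bdd (c := C)
    (hφ.continuous.comp (continuous_const.sub continuous_id)).aestronglyMeasurable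
    (Filter.Eventually.of_forall fun z => hC _)

lemma continuous_avg (hφ : IsJumpDensity φ) (u : L2 a b) : Continuous (avg φ u) := by
  obtain ⟨C, hC⟩ := hφ.exists_bound
  refine continuous_of_dominated (bound := fun z => |zeroExt u z| * C)
    (fun x => (hφ.integrable_mul (integrable_zeroExt u) x).aestronglyMeasurable)
    (fun x => Filter.Eventually.of_forall fun z => ?_)
    ((integrable_zeroExt u).abs.mul_const C) (Filter.Eventually.of_forall fun z => ?_)
  · rw [norm_mul]
    exact mul_le_mul_of_nonneg_left (hC _) (abs_nonneg _)
  · exact continuous_const.mul (hφ.continuous.comp (continuous_id.sub continuous_const))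

lemma avg_add (hφ : IsJumpDensity φ) (u v : L2 a b) (x : ℝ) :
    avg φ (u + v) x = avg φ u x + avg φ v x := by
  rw [avg, avg, avg, ← integral_add (hφ.integrable_mul (integrable_zeroExt u) x)
    (hφ.integrable_mul (integrable_zeroExt v) x)]
  refine integral_congr_ae ?_
  filter_upwards [zeroExt_add u v] with z hz
  rw [hz, Pi.add_apply, add_mul]

lemma avg_smul (c : ℝ) (u : L2 a b) (x : ℝ) : avg φ (c • u) x = c * avg φ u x := by
  rw [avg, avg, ← integral_const_mul]
  refine integral_congr_ae ?_
  filter_upwards [zeroExt_smul c u] with z hz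
  rw [hz, Pi.smul_apply, smul_eq_mul, mul_assoc]

lemma IsJumpDensity.integral_comp_sub (hφ : IsJumpDensity φ) (x : ℝ) : ∫ z, φ (x - z) = 1 := by
  rw [integral_sub_left_eq_self φ volume x, hφ.integral_eq_one]

/-- Jensen's inequality for the jump average: the variance is nonnegative. -/
lemma avg_sq_le (hφ : IsJumpDensity φ) (u : L2 a b) (x : ℝ) :
    avg φ u x ^ 2 ≤ ∫ z, zeroExt u z ^ 2 * φ (x - z) := by
  have h1 := hφ.integrable_mul (integrable_zeroExt_sq u) x
  have h2 := (hφ.integrable_mul (integrable_zeroExt u) x).const_mul (2 * avg φ u x)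
  have h3 : Integrable fun z => avg φ u x ^ 2 * φ (x - z) :=
    (hφ.integrable.comp_sub_left x).const_mul _
  have h0 : 0 ≤ ∫ z, (zeroExt u z - avg φ u x) ^ 2 * φ (x - z) :=
    integral_nonneg fun z => mul_nonneg (sq_nonneg _) (hφ.nonneg _)
  have h4 : ∫ z, (zeroExt u z - avg φ u x) ^ 2 * φ (x - z) =
      ∫ z, (zeroExt u z ^ 2 * φ (x - z) - 2 * avg φ u x * (zeroExt u z * φ (x - z))
        + avg φ u x ^ 2 * φ (x - z)) := by
    congr 1; ext z; ring
  have h12 : Integrable fun z =>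
      zeroExt u z ^ 2 * φ (x - z) - 2 * avg φ u x * (zeroExt u z * φ (x - z)) := h1.sub h2
  rw [h4, integral_add h12 h3, integral_sub h1 h2, integral_const_mul, integral_const_mul,
    hφ.integral_comp_sub, ← avg] at h0
  nlinarith

lemma integral_avg_sq_le (hφ : IsJumpDensity φ) (u : L2 a b) :
    ∫ x in Ioo a b, avg φ u x ^ 2 ≤ ‖u‖ ^ 2 := by
  have hconv := (integrable_zeroExt_sq u).integrable_convolution
    (ContinuousLinearMap.mul ℝ ℝ) hφ.integrable
  have hint := integral_convolution (ContinuousLinearMap.mul ℝ ℝ) (integrable_zeroExt_sq u)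
    hφ.integrable
  simp only [ContinuousLinearMap.mul_apply', hφ.integral_eq_one, mul_one,
    integral_zeroExt_sq] at hint
  rw [← hint]
  refine (setIntegral_mono_on ((memLp_of_continuous (f := fun x => avg φ u x ^ 2)
    ((continuous_avg hφ u).pow 2)).integrable one_le_two) hconv.integrableOn measurableSet_Ioo
    fun x _ => avg_sq_le hφ u x).trans ?_
  exact setIntegral_le_integral hconv (Filter.Eventually.of_forall fun x =>
    integral_nonneg fun z => mul_nonneg (sq_nonneg _) (hφ.nonneg _))

lemma norm_toLp_avg_le (hφ : IsJumpDensity φ) (u : L2 a b) :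
    ‖(memLp_of_continuous (a := a) (b := b) (continuous_avg hφ u)).toLp (avg φ u)‖ ≤ ‖u‖ := by
  refine le_of_sq_le_sq ?_ (norm_nonneg _)
  refine le_trans (le_of_eq ?_) (integral_avg_sq_le hφ u)
  rw [← real_inner_self_eq_norm_sq, inner_eq_integral]
  refine integral_congr_ae ?_
  filter_upwards [(memLp_of_continuous (continuous_avg hφ u)).coeFn_toLp] with x hx
  rw [hx, sq]

/-- The jump average as an operator on `L_2(a,b)`. -/
noncomputable def avgOp (hφ : IsJumpDensity φ) : L2 a b →L[ℝ] L2 a b :=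
  LinearMap.mkContinuous
    { toFun := fun u => (memLp_of_continuous (continuous_avg hφ u)).toLp (avg φ u)
      map_add' := fun u v => by
        rw [← MemLp.toLp_add]
        exact MemLp.toLp_congr _ _ (Filter.Eventually.of_forall fun x => avg_add hφ u v x)
      map_smul' := fun c u => by
        rw [RingHom.id_apply, ← MemLp.toLp_const_smul]
        exact MemLp.toLp_congr _ _ (Filter.Eventually.of_forall fun x => avg_smul c u x) }
    1 fun u => by
      rw [one_mul]
      exact norm_toLp_avg_le hφ u

lemma coe_avgOp (hφ : IsJumpDensity φ) (u : L2 a b) :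
    avgOp hφ u =ᵐ[volume.restrict (Ioo a b)] avg φ u :=
  (memLp_of_continuous (continuous_avg hφ u)).coeFn_toLp

lemma norm_avgOp_le (hφ : IsJumpDensity φ) (u : L2 a b) : ‖avgOp hφ u‖ ≤ ‖u‖ :=
  norm_toLp_avg_le hφ u

lemma inner_avgOp (hφ : IsJumpDensity φ) (u v : L2 a b) :
    ⟪avgOp hφ u, v⟫_ℝ = ⟪u, avgOp hφ v⟫_ℝ := by
  rw [real_inner_comm, real_inner_comm (avgOp hφ v),
    inner_eq_integral_zeroExt_mul _ _ (coe_avgOp hφ v), real_inner_comm,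
    inner_eq_integral_zeroExt_mul _ _ (coe_avgOp hφ u)]
  simp only [avg, ← integral_mul_const]
  have hint : Integrable (Function.uncurry fun x z => zeroExt u z * φ (x - z) * zeroExt v x)
      (volume.prod volume) := by
    obtain ⟨C, hC⟩ := hφ.exists_bound
    refine (((integrable_zeroExt v).mul_prod (integrable_zeroExt u)).mul_bdd (c := C)
      (g := fun p : ℝ × ℝ => φ (p.1 - p.2))
      (hφ.continuous.comp (continuous_fst.sub continuous_snd)).aestronglyMeasurable
      (Filter.Eventually.of_forall fun z => hC _)).congr
      (Filter.Eventually.of_forall fun p => ?_)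
    simp only [Function.uncurry]
    ring
  rw [integral_integral_swap hint]
  congr 1; ext x; congr 1; ext z
  rw [← hφ.symm, neg_sub]; ring

lemma opI_eq (hφ : IsJumpDensity φ) (lam : ℝ) (u : L2 a b) {V : ℝ → ℝ}
    (hV : V =ᵐ[volume] zeroExt u) (x : ℝ) : opI lam φ V x = lam * (avg φ u x - V x) := by
  have h1 : ∀ z, φ (z - x) = φ (x - z) := fun z => by rw [← hφ.symm, neg_sub]
  have hae : (fun z => V z * φ (x - z)) =ᵐ[volume] fun z => zeroExt u z * φ (x - z) := by
    filter_upwards [hV] with z hz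
    rw [hz]
  rw [opI, ← integral_sub_right_eq_self (fun y => (V (x + y) - V x) * φ y) x]
  simp only [add_sub_cancel, h1, sub_mul]
  rw [integral_sub ((hφ.integrable_mul (integrable_zeroExt u) x).congr hae.symm)
    ((hφ.integrable.comp_sub_left x).const_mul _), integral_const_mul, hφ.integral_comp_sub,
    integral_congr_ae hae, avg, mul_one]

lemma formA_eq (hφ : IsJumpDensity φ) (μ σ lam : ℝ) (u v : L2 a b) :
    formA μ σ lam φ u v = 1 / 2 * σ ^ 2 * ⟪D u, D v⟫_ℝ + μ * ⟪mulX (D u), v⟫_ℝ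
      - lam * (⟪avgOp hφ u, v⟫_ℝ - ⟪u, v⟫_ℝ) := by
  have h1 : formL μ σ u v = 1 / 2 * σ ^ 2 * ⟪D u, D v⟫_ℝ + μ * ⟪mulX (D u), v⟫_ℝ := by
    rw [formL, inner_eq_integral, inner_eq_integral, ← integral_const_mul, ← integral_const_mul,
      ← integral_add ((integrable_coe_mul _ _).const_mul _) ((integrable_coe_mul _ _).const_mul _)]
    refine integral_congr_ae ?_
    filter_upwards [coe_mulX (D u)] with x hx
    rw [hx]; ring
  have h2 : formI lam φ u v = lam * (⟪avgOp hφ u, v⟫_ℝ - ⟪u, v⟫_ℝ) := by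
    rw [formI, inner_eq_integral, inner_eq_integral, ← integral_sub (integrable_coe_mul _ _)
      (integrable_coe_mul _ _), ← integral_const_mul]
    refine integral_congr_ae ?_
    filter_upwards [coe_avgOp hφ u, zeroExt_ae_eq u] with x hx hz
    rw [hx, opI_eq hφ lam u (Filter.EventuallyEq.refl _ _), hz]; ring
  rw [formA, h1, h2]

/-! ### Integration by parts and the Poincaré inequality -/

lemma inner_D_of_memH1 (hab : a < b) {u v : L2 a b} (hu : MemH1 u) (hv : MemH10 v) :
    ⟪D u, v⟫_ℝ = -⟪u, D v⟫_ℝ := by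
  obtain ⟨hb, hv⟩ := hv.prim_D_and_eq hab
  obtain ⟨c, hc⟩ := hu.isWeakDeriv.exists_ae_eq hab
  have h : u = c • one a b + volt (D u) := by
    refine Lp.ext ?_
    filter_upwards [hc, coe_volt (D u), Lp.coeFn_add (c • one a b) (volt (D u)),
      Lp.coeFn_smul c (one a b), coe_one] with x h1 h2 h3 h4 h5
    rw [h3, Pi.add_apply, h4, Pi.smul_apply, h5, h1, h2, smul_eq_mul, mul_one]
  have h1 := inner_volt_add_inner_volt hab.le (D u) (D v)
  have h2 : ⟪u, D v⟫_ℝ = ⟪volt (D u), D v⟫_ℝ := by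
    conv_lhs => rw [h]
    rw [inner_add_left, real_inner_smul_left, inner_one_eq_prim hab.le, hb, mul_zero, zero_add]
  rw [hb, mul_zero, ← hv] at h1
  rw [h2]
  linarith

lemma IsTestFunction.mul_left {ψ f : ℝ → ℝ} (hψ : IsTestFunction a b ψ) (hf : ContDiff ℝ ∞ f) :
    IsTestFunction a b fun x => f x * ψ x :=
  ⟨hf.mul hψ.1, hψ.2.1.mul_left, tsupport_mul_subset_right.trans hψ.2.2⟩

/-- The product rule for multiplication by `x`. -/
lemma IsWeakDeriv.mulX {u d : L2 a b} (h : IsWeakDeriv u d) :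
    IsWeakDeriv (mulX u) (u + OUJump.mulX d) := by
  intro ψ hψ
  have hxψ : IsTestFunction a b fun x => x * ψ x := hψ.mul_left contDiff_id
  have key := h _ hxψ
  have hder : ∀ x, deriv (fun x => x * ψ x) x = ψ x + x * deriv ψ x := fun x => by
    simpa using! ((hasDerivAt_id x).mul (hψ.differentiable x).hasDerivAt).deriv
  simp only [hder] at key
  have h1 : ∫ x in Ioo a b, OUJump.mulX u x * deriv ψ x
      = ∫ x in Ioo a b, (u x * (ψ x + x * deriv ψ x) - u x * ψ x) := by
    refine integral_congr_ae ?_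
    filter_upwards [coe_mulX u] with x hx
    rw [hx]; ring
  have h2 : ∫ x in Ioo a b, (u + OUJump.mulX d) x * ψ x
      = ∫ x in Ioo a b, (u x * ψ x + d x * (x * ψ x)) := by
    refine integral_congr_ae ?_
    filter_upwards [coe_mulX d, Lp.coeFn_add u (OUJump.mulX d)] with x hx h
    rw [h, Pi.add_apply, hx]; ring
  have hc := hψ.1.continuous
  rw [h1, h2, integral_sub (integrable_mul_continuous u (f := fun x => ψ x + x * deriv ψ x)
      (hc.add (continuous_id.mul hψ.continuous_deriv))) (integrable_mul_continuous u hc),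
    integral_add (integrable_mul_continuous u hc)
      (integrable_mul_continuous d (f := fun x => x * ψ x) (continuous_id.mul hc)), key]
  ring

lemma MemH10.mulX {v : L2 a b} (hv : MemH10 v) : MemH10 (mulX v) := by
  obtain ⟨h, V, hVc, hV, hVa, hVb⟩ := hv
  refine ⟨⟨_, h.isWeakDeriv.mulX⟩, fun x => x * V x, continuousOn_id.mul hVc, ?_, by simp [hVa],
    by simp [hVb]⟩
  filter_upwards [hV, coe_mulX v] with x h1 h2
  rw [h2, h1]

/-- Integration by parts in the drift term. -/
lemma inner_mulX_D (hab : a < b) {u v : L2 a b} (hu : MemH10 u) (hv : MemH10 v) :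
    ⟪mulX (D u), v⟫_ℝ = -⟪mulX (D v), u⟫_ℝ - ⟪u, v⟫_ℝ := by
  have h := inner_D_of_memH1 hab hu.mulX.1 hv
  rw [D_eq hu.1.isWeakDeriv.mulX, inner_add_left, inner_mulX u, real_inner_comm (OUJump.mulX (D v)) u] at h
  linarith

lemma inner_mulX_D_self (hab : a < b) {v : L2 a b} (hv : MemH10 v) :
    ⟪mulX (D v), v⟫_ℝ = -(1 / 2) * ‖v‖ ^ 2 := by
  have h := inner_mulX_D hab hv hv
  rw [real_inner_self_eq_norm_sq] at h
  linarith

/-- Test functions belong to `H^1_0(a,b)`, so that an identity tested with `H^1_0(a,b)` yields a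
weak derivative. -/
lemma isWeakDeriv_of_forall_inner (hab : a ≤ b) {p h : L2 a b}
    (H : ∀ ψ : L2 a b, MemH10 ψ → ⟪p, D ψ⟫_ℝ = -⟪h, ψ⟫_ℝ) : IsWeakDeriv p h := by
  intro ψ hψ
  have hψm := memLp_of_continuous (a := a) (b := b) hψ.1.continuous
  have hψm' := memLp_of_continuous (a := a) (b := b) hψ.continuous_deriv
  have hψw : IsWeakDeriv (hψm.toLp ψ) (hψm'.toLp (deriv ψ)) := by
    intro χ hχ
    have hac : ∀ {χ}, IsTestFunction a b χ → AbsolutelyContinuousOnInterval χ a b :=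
      fun hχ => (hχ.1.of_le (by simp)).contDiffOn.absolutelyContinuousOnInterval
    have key := integral_eq_sub_of_ac (f' := fun x => deriv ψ x * χ x + ψ x * deriv χ x) hab
      ((hac hψ).fun_mul (hac hχ)) (Filter.Eventually.of_forall fun x =>
        (hψ.differentiable x).hasDerivAt.mul (hχ.differentiable x).hasDerivAt)
    have hi : ∀ {f g : ℝ → ℝ}, Continuous f → Continuous g →
        Integrable (fun x => f x * g x) (volume.restrict (Ioo a b)) := fun hf hg =>
      (memLp_of_continuous hf).integrable_mul (memLp_of_continuous hg)
    rw [integral_add (hi hψ.continuous_deriv hχ.1.continuous)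
      (hi hψ.1.continuous hχ.continuous_deriv), hψ.eq_zero (x := a) (by simp),
      hψ.eq_zero (x := b) (by simp)] at key
    have h1 : ∫ x in Ioo a b, hψm.toLp ψ x * deriv χ x = ∫ x in Ioo a b, ψ x * deriv χ x := by
      refine integral_congr_ae ?_
      filter_upwards [hψm.coeFn_toLp] with x hx
      rw [hx]
    have h2 : ∫ x in Ioo a b, hψm'.toLp (deriv ψ) x * χ x = ∫ x in Ioo a b, deriv ψ x * χ x := by
      refine integral_congr_ae ?_
      filter_upwards [hψm'.coeFn_toLp] with x hx
      rw [hx]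
    rw [h1, h2]
    linarith
  have hmem : MemH10 (hψm.toLp ψ) := ⟨⟨_, hψw⟩, ψ, hψ.1.continuous.continuousOn,
    hψm.coeFn_toLp.symm, hψ.eq_zero (by simp), hψ.eq_zero (by simp)⟩
  have key := H _ hmem
  rw [D_eq hψw, inner_eq_integral, inner_eq_integral] at key
  have h1 : ∫ x in Ioo a b, p x * hψm'.toLp (deriv ψ) x = ∫ x in Ioo a b, p x * deriv ψ x := by
    refine integral_congr_ae ?_
    filter_upwards [hψm'.coeFn_toLp] with x hx
    rw [hx]
  have h2 : ∫ x in Ioo a b, h x * hψm.toLp ψ x = ∫ x in Ioo a b, h x * ψ x := by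
    refine integral_congr_ae ?_
    filter_upwards [hψm.coeFn_toLp] with x hx
    rw [hx]
  rwa [h1, h2] at key

/-- The Poincaré inequality with a constant below the optimal one. For `T(x) = tan (k (x - m))` with
the midpoint `m`, the function `k T P²` vanishes at both ends and
`P'² - k² P² = (P' + k T P)² - (k T P²)'`. -/
lemma mul_norm_volt_le (hab : a < b) {p : L2 a b} (hp : prim p b = 0) {k : ℝ} (hk0 : 0 < k)
    (hk : k < Real.pi / (b - a)) : k * ‖volt p‖ ≤ ‖p‖ := by
  have hL : 0 < b - a := sub_pos.2 hab
  have hkL : k * (b - a) < Real.pi := (lt_div_iff₀ hL).1 hk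
  set m := (a + b) / 2 with hm
  have hcos : ∀ x ∈ Icc a b, Real.cos (k * (x - m)) ≠ 0 := fun x hx =>
    (Real.cos_pos_of_mem_Ioo ⟨by nlinarith [hx.1], by nlinarith [hx.2]⟩).ne'
  have hT : AbsolutelyContinuousOnInterval (fun x => k * Real.tan (k * (x - m))) a b := by
    refine ContDiffOn.absolutelyContinuousOnInterval fun x hx => ?_
    rw [uIcc_of_le hab.le] at hx
    exact (contDiffAt_const.mul ((Real.contDiffAt_tan.2 (hcos x hx)).comp x
      (contDiffAt_const.mul (contDiffAt_id.sub contDiffAt_const)))).contDiffWithinAt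
  have hac := hT.fun_mul ((ac_prim p).fun_mul (ac_prim p))
  let f' : ℝ → ℝ := fun x => k ^ 2 * (1 + Real.tan (k * (x - m)) ^ 2) * prim p x ^ 2
    + 2 * k * Real.tan (k * (x - m)) * (prim p x * p x)
  have hder : ∀ᵐ x ∂volume.restrict (Ioo a b),
      HasDerivAt (fun x => k * Real.tan (k * (x - m)) * (prim p x * prim p x)) (f' x) x := by
    filter_upwards [ae_hasDerivAt_prim_restrict p, ae_restrict_mem measurableSet_Ioo] with x hx hx'
    have hc := hcos x (Ioo_subset_Icc_self hx')
    have h1 : HasDerivAt (fun x => k * (x - m)) k x := by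
      simpa using ((hasDerivAt_id x).sub_const m).const_mul k
    have h2 := ((Real.hasDerivAt_tan hc).comp x h1).const_mul k
    have h3 := h2.mul (hx.mul hx)
    have h4 : 1 / Real.cos (k * (x - m)) ^ 2 = 1 + Real.tan (k * (x - m)) ^ 2 := by
      rw [← Real.inv_one_add_tan_sq hc, one_div, inv_inv]
    refine HasDerivAt.congr_deriv (f := fun x => k * Real.tan (k * (x - m)) *
      (prim p x * prim p x)) h3 ?_
    rw [h4]
    simp only [f', Function.comp, Pi.mul_apply]
    ring
  have hzero := integral_eq_sub_of_ac hab.le hac hder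
  simp only [hp, prim_left, mul_zero, sub_self] at hzero
  have hint : Integrable f' (volume.restrict (Ioo a b)) := by
    have h := hac.intervalIntegrable_deriv.1.mono_set (Ioo_subset_Ioc_self)
    refine h.congr ?_
    filter_upwards [hder] with x hx
    exact hx.deriv
  have hnonneg : 0 ≤ ∫ x in Ioo a b, (p x * p x - k ^ 2 * (volt p x * volt p x) + f' x) := by
    refine integral_nonneg_of_ae ?_
    filter_upwards [coe_volt p] with x hx
    have : p x * p x - k ^ 2 * (volt p x * volt p x) + f' x
        = (p x + k * Real.tan (k * (x - m)) * prim p x) ^ 2 := by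
      simp only [f', hx]; ring
    rw [this]
    exact sq_nonneg _
  have hint2 : Integrable (fun x => p x * p x - k ^ 2 * (volt p x * volt p x))
      (volume.restrict (Ioo a b)) :=
    (integrable_coe_mul _ _).sub ((integrable_coe_mul _ _).const_mul _)
  rw [integral_add hint2 hint, hzero, integral_sub (integrable_coe_mul _ _)
    ((integrable_coe_mul _ _).const_mul _), integral_const_mul, ← inner_eq_integral,
    ← inner_eq_integral, real_inner_self_eq_norm_sq, real_inner_self_eq_norm_sq] at hnonneg
  exact le_of_sq_le_sq (by nlinarith) (norm_nonneg _)

/-- The Poincaré inequality with the optimal constant `(b - a) / π`. -/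
lemma norm_le_c2_mul (hab : a < b) {v : L2 a b} (hv : MemH10 v) : ‖v‖ ≤ c2 a b * ‖D v‖ := by
  obtain ⟨hb, hv⟩ := hv.prim_D_and_eq hab
  have hK : 0 < Real.pi / (b - a) := div_pos Real.pi_pos (sub_pos.2 hab)
  have h : closure (Ioo 0 (Real.pi / (b - a))) ⊆ {k | k * ‖volt (D v)‖ ≤ ‖D v‖} :=
    closure_minimal (fun k hk => mul_norm_volt_le hab hb hk.1 hk.2)
      (isClosed_le (continuous_id.mul continuous_const) continuous_const)
  rw [closure_Ioo hK.ne] at h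
  have h1 : Real.pi / (b - a) * ‖volt (D v)‖ ≤ ‖D v‖ := h (right_mem_Icc.2 hK.le)
  rw [← hv] at h1
  have h2 : c2 a b = (Real.pi / (b - a))⁻¹ := by rw [c2, inv_div]
  rw [h2, ← div_eq_inv_mul, le_div_iff₀ hK]
  linarith

lemma memH10_zero (hab : a ≤ b) : MemH10 (0 : L2 a b) := by
  have h : prim (0 : L2 a b) b = 0 := by simpa using prim_smul 0 (0 : L2 a b) b
  simpa using memH10_volt hab h

lemma MemH10.add (hab : a < b) {u v : L2 a b} (hu : MemH10 u) (hv : MemH10 v) :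
    MemH10 (u + v) := by
  obtain ⟨h1, h2⟩ := hu.prim_D_and_eq hab
  obtain ⟨h3, h4⟩ := hv.prim_D_and_eq hab
  rw [h2, h4, ← map_add]
  exact memH10_volt hab.le (by rw [prim_add, h1, h3, add_zero])

lemma MemH10.smul (hab : a < b) {u : L2 a b} (c : ℝ) (hu : MemH10 u) : MemH10 (c • u) := by
  obtain ⟨h1, h2⟩ := hu.prim_D_and_eq hab
  rw [h2, ← map_smul]
  exact memH10_volt hab.le (by rw [prim_smul, h1, mul_zero])

lemma MemH10.sub (hab : a < b) {u v : L2 a b} (hu : MemH10 u) (hv : MemH10 v) :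
    MemH10 (u - v) := by
  rw [sub_eq_add_neg, ← neg_one_smul ℝ v]
  exact hu.add hab (hv.smul hab _)

lemma MemH10.D_sub (hab : a < b) {u v : L2 a b} (hu : MemH10 u) (hv : MemH10 v) :
    D (u - v) = D u - D v := by
  obtain ⟨-, h2⟩ := hu.prim_D_and_eq hab
  obtain ⟨-, h4⟩ := hv.prim_D_and_eq hab
  conv_lhs => rw [h2, h4, ← map_sub, D_volt hab.le]

/-! ### The shifted problem and its regularity -/

/-- `v` is a weak solution of the shifted problem `ℒ v - ℐ v + t v = f`, `v = 0` outside `(a,b)`. -/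
def IsShiftedSolution (μ σ lam t : ℝ) (φ : ℝ → ℝ) (f v : L2 a b) : Prop :=
  MemH10 v ∧ ∀ ψ : L2 a b, MemH10 ψ → formA μ σ lam φ v ψ + t * ⟪v, ψ⟫_ℝ = ⟪f, ψ⟫_ℝ

/-- `w` is a weak solution of the adjoint of the shifted problem. -/
def IsShiftedAdjointSolution (μ σ lam t : ℝ) (φ : ℝ → ℝ) (g w : L2 a b) : Prop :=
  MemH10 w ∧ ∀ ψ : L2 a b, MemH10 ψ → formA μ σ lam φ ψ w + t * ⟪ψ, w⟫_ℝ = ⟪ψ, g⟫_ℝ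

lemma IsShiftedSolution.sub (hab : a < b) (hφ : IsJumpDensity φ) {f v g w : L2 a b}
    (hv : IsShiftedSolution μ σ lam t φ f v) (hw : IsShiftedSolution μ σ lam t φ g w) :
    IsShiftedSolution μ σ lam t φ (f - g) (v - w) := by
  refine ⟨hv.1.sub hab hw.1, fun ψ hψ => ?_⟩
  have h1 := hv.2 ψ hψ
  have h2 := hw.2 ψ hψ
  rw [formA_eq hφ] at h1 h2 ⊢
  rw [hv.1.D_sub hab hw.1]
  simp only [map_sub, inner_sub_left] at *
  linarith

lemma IsShiftedAdjointSolution.sub (hab : a < b) (hφ : IsJumpDensity φ) {f v g w : L2 a b}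
    (hv : IsShiftedAdjointSolution μ σ lam t φ f v)
    (hw : IsShiftedAdjointSolution μ σ lam t φ g w) :
    IsShiftedAdjointSolution μ σ lam t φ (f - g) (v - w) := by
  refine ⟨hv.1.sub hab hw.1, fun ψ hψ => ?_⟩
  have h1 := hv.2 ψ hψ
  have h2 := hw.2 ψ hψ
  rw [formA_eq hφ] at h1 h2 ⊢
  rw [hv.1.D_sub hab hw.1]
  simp only [inner_sub_right] at *
  linarith

lemma isShiftedSolution_zero (hab : a < b) (hφ : IsJumpDensity φ) :
    IsShiftedSolution μ σ lam t φ (0 : L2 a b) 0 := by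
  have hD : D (0 : L2 a b) = 0 := by simpa using D_volt hab.le (0 : L2 a b)
  refine ⟨memH10_zero hab.le, fun ψ _ => ?_⟩
  rw [formA_eq hφ, hD]
  simp

/-- The second weak derivative of a solution, read off from the equation. -/
lemma IsShiftedSolution.isWeakDeriv_D (hab : a < b) (hσ : 0 < σ) (hφ : IsJumpDensity φ)
    {f v : L2 a b} (hv : IsShiftedSolution μ σ lam t φ f v) :
    IsWeakDeriv (D v)
      ((2 / σ ^ 2) • (μ • mulX (D v) - lam • (avgOp hφ v - v) + t • v - f)) := by
  refine isWeakDeriv_of_forall_inner hab.le fun ψ hψ => ?_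
  have h := hv.2 ψ hψ
  rw [formA_eq hφ] at h
  simp only [real_inner_smul_left, inner_sub_left, inner_add_left]
  field_simp
  linarith

/-- The second weak derivative of an adjoint solution, read off from the equation. -/
lemma IsShiftedAdjointSolution.isWeakDeriv_D (hab : a < b) (hσ : 0 < σ) (hφ : IsJumpDensity φ)
    {g w : L2 a b} (hw : IsShiftedAdjointSolution μ σ lam t φ g w) :
    IsWeakDeriv (D w)
      ((2 / σ ^ 2) • (-(μ • mulX (D w)) - μ • w - lam • (avgOp hφ w - w) + t • w - g)) := by
  refine isWeakDeriv_of_forall_inner hab.le fun ψ hψ => ?_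
  have h := hw.2 ψ hψ
  rw [formA_eq hφ, inner_mulX_D hab hψ hw.1, inner_avgOp, real_inner_comm (D w),
    real_inner_comm w, real_inner_comm (avgOp hφ w), real_inner_comm g] at h
  simp only [real_inner_smul_left, inner_sub_left, inner_add_left, inner_neg_left]
  field_simp
  linarith

lemma prim_eq_integral_of_ae {u : L2 a b} {g : ℝ → ℝ} (h : u =ᵐ[volume.restrict (Ioo a b)] g)
    {x : ℝ} (hx : x ∈ Icc a b) : prim u x = ∫ s in a..x, g s := by
  have h0 : ∀ᵐ s : ℝ, s ≠ b := by simp [ae_iff, measure_singleton]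
  refine intervalIntegral.integral_congr_ae ?_
  filter_upwards [(ae_restrict_iff' measurableSet_Ioo).1 ((zeroExt_ae_eq u).trans h), h0]
    with s hs hsb hsx
  rw [uIoc_of_le hx.1] at hsx
  exact hs ⟨hsx.1, lt_of_le_of_ne (hsx.2.trans hx.2) hsb⟩

/-- A solution with continuous right-hand side is twice continuously differentiable up to the
boundary and solves the equation pointwise. -/
lemma IsShiftedSolution.exists_contDiff (hab : a < b) (hσ : 0 < σ) (hφ : IsJumpDensity φ)
    {f v : L2 a b} (hv : IsShiftedSolution μ σ lam t φ f v) {F : ℝ → ℝ}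
    (hF : ContinuousOn F (Icc a b)) (hfF : f =ᵐ[volume.restrict (Ioo a b)] F) :
    ∃ U : ℝ → ℝ, ContDiff ℝ 2 U ∧ U a = 0 ∧ U b = 0 ∧ v =ᵐ[volume.restrict (Ioo a b)] U ∧
      ∀ x ∈ Ioo a b, opL μ σ U x - lam * (avg φ v x - U x) + t * U x = F x := by
  -- replace `F` by a function that is continuous on the whole line
  wlog hFc : Continuous F generalizing F
  · have hext : Continuous (IccExtend hab.le ((Icc a b).domRestrict F)) :=
      hF.domRestrict.Icc_extend'
    have heq : ∀ x ∈ Icc a b, IccExtend hab.le ((Icc a b).domRestrict F) x = F x := fun x hx => by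
      rw [IccExtend_of_mem _ _ hx, domRestrict_apply]
    obtain ⟨U, h1, h2, h3, h4, h5⟩ := this hext.continuousOn (hfF.trans (by
      filter_upwards [ae_restrict_mem measurableSet_Ioo] with x hx
      exact (heq x (Ioo_subset_Icc_self hx)).symm)) hext
    exact ⟨U, h1, h2, h3, h4, fun x hx => (h5 x hx).trans (heq x (Ioo_subset_Icc_self hx))⟩
  obtain ⟨hb, hvp⟩ := hv.1.prim_D_and_eq hab
  have hvp' : v =ᵐ[volume.restrict (Ioo a b)] prim (D v) := by
    conv_lhs => rw [hvp]
    exact coe_volt _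
  have hq := hv.isWeakDeriv_D hab hσ hφ
  set q := (2 / σ ^ 2) • (μ • mulX (D v) - lam • (avgOp hφ v - v) + t • v - f) with hqdef
  obtain ⟨c, hc⟩ := hq.exists_ae_eq hab
  let Q : ℝ → ℝ := fun x => 2 / σ ^ 2 * (μ * (x * (c + prim q x)) - lam * (avg φ v x - prim (D v) x)
    + t * prim (D v) x - F x)
  have hQc : Continuous Q := by
    have h1 := continuous_prim q
    have h2 := continuous_prim (D v)
    have h3 := continuous_avg hφ v
    fun_prop
  have hqQ : q =ᵐ[volume.restrict (Ioo a b)] Q := by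
    filter_upwards [Lp.coeFn_smul (2 / σ ^ 2)
        (μ • mulX (D v) - lam • (avgOp hφ v - v) + t • v - f),
      Lp.coeFn_sub (μ • mulX (D v) - lam • (avgOp hφ v - v) + t • v) f,
      Lp.coeFn_add (μ • mulX (D v) - lam • (avgOp hφ v - v)) (t • v),
      Lp.coeFn_sub (μ • mulX (D v)) (lam • (avgOp hφ v - v)), Lp.coeFn_smul μ (mulX (D v)),
      Lp.coeFn_smul lam (avgOp hφ v - v), Lp.coeFn_sub (avgOp hφ v) v, Lp.coeFn_smul t v,
      coe_mulX (D v), coe_avgOp hφ v, hvp', hc, hfF] with x h1 h2 h3 h4 h5 h6 h7 h8 h9 h10 h11 h12 h13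
    simp only [Pi.smul_apply, Pi.sub_apply, Pi.add_apply, smul_eq_mul] at h1 h2 h3 h4 h5 h6 h7 h8
    rw [hqdef, h1, h2, h3, h4, h5, h6, h7, h8, h9, h10, h11, h12, h13]
  let P : ℝ → ℝ := fun x => c + ∫ s in a..x, Q s
  have hPc : Continuous P :=
    continuous_const.add (intervalIntegral.continuous_primitive
      (fun _ _ => hQc.intervalIntegrable _ _) a)
  have hP : ∀ x, HasDerivAt P (Q x) x := fun x =>
    (intervalIntegral.integral_hasDerivAt_right (hQc.intervalIntegrable _ _)
      hQc.aestronglyMeasurable.stronglyMeasurableAtFilter hQc.continuousAt).const_add c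
  have hprimq : ∀ x ∈ Icc a b, c + prim q x = P x := fun x hx => by
    rw [prim_eq_integral_of_ae hqQ hx]
  have hDP : D v =ᵐ[volume.restrict (Ioo a b)] P := by
    filter_upwards [hc, ae_restrict_mem measurableSet_Ioo] with x h1 hx
    rw [h1, hprimq x (Ioo_subset_Icc_self hx)]
  let U : ℝ → ℝ := fun x => ∫ s in a..x, P s
  have hU : ∀ x, HasDerivAt U (P x) x := fun x =>
    intervalIntegral.integral_hasDerivAt_right (hPc.intervalIntegrable _ _)
      hPc.aestronglyMeasurable.stronglyMeasurableAtFilter hPc.continuousAt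
  have hprimU : ∀ x ∈ Icc a b, prim (D v) x = U x := fun x hx => prim_eq_integral_of_ae hDP hx
  have hdU : deriv U = P := funext fun x => (hU x).deriv
  have hdP : deriv P = Q := funext fun x => (hP x).deriv
  refine ⟨U, ?_, intervalIntegral.integral_same, ?_, ?_, fun x hx => ?_⟩
  · have h1 : ContDiff ℝ 1 P :=
      contDiff_one_iff_deriv.2 ⟨fun x => (hP x).differentiableAt, hdP ▸ hQc⟩
    rw [show (2 : WithTop ℕ∞) = 1 + 1 by norm_num, contDiff_succ_iff_deriv]
    exact ⟨fun x => (hU x).differentiableAt, by simp, hdU ▸ h1⟩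
  · rw [← hprimU b (right_mem_Icc.2 hab.le), hb]
  · filter_upwards [hvp', ae_restrict_mem measurableSet_Ioo] with x h1 hx
    rw [h1, hprimU x (Ioo_subset_Icc_self hx)]
  · have hx' := Ioo_subset_Icc_self hx
    rw [opL, hdU, hdP]
    simp only [Q, hprimq x hx', hprimU x hx']
    field_simp
    ring

/-! ### The maximum principle -/

lemma gammaHat_pos (hσ : 0 < σ) (hlam : 0 < lam) : 0 < gammaHat b μ σ lam := by
  have h1 : (μ * b / σ ^ 2) ^ 2 < μ ^ 2 * b ^ 2 / σ ^ 4 + 2 * (lam + 1) / σ ^ 2 := by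
    have : (μ * b / σ ^ 2) ^ 2 = μ ^ 2 * b ^ 2 / σ ^ 4 := by ring
    rw [this]
    have : 0 < 2 * (lam + 1) / σ ^ 2 := by positivity
    linarith
  have h2 := Real.lt_sqrt_of_sq_lt (x := |μ * b / σ ^ 2|) (by rwa [sq_abs])
  rw [gammaHat]
  linarith [neg_abs_le (μ * b / σ ^ 2)]

/-- The defining equation of `γ`; its right-hand side exceeds `lam`, which is what makes the barrier
strict in the presence of jumps. -/
lemma gammaHat_root (hσ : 0 < σ) (hlam : 0 < lam) :
    1 / 2 * σ ^ 2 * gammaHat b μ σ lam ^ 2 - μ * b * gammaHat b μ σ lam = lam + 1 := by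
  have h : 0 ≤ μ ^ 2 * b ^ 2 / σ ^ 4 + 2 * (lam + 1) / σ ^ 2 := by positivity
  have hs := Real.sq_sqrt h
  rw [gammaHat]
  set r := √(μ ^ 2 * b ^ 2 / σ ^ 4 + 2 * (lam + 1) / σ ^ 2)
  have h2 : σ ^ 4 * r ^ 2 = μ ^ 2 * b ^ 2 + 2 * (lam + 1) * σ ^ 2 := by
    rw [hs]; field_simp
  field_simp
  nlinarith

lemma one_le_c4 (hab : a ≤ b) (hσ : 0 < σ) (hlam : 0 < lam) : 1 ≤ c4 a b μ σ lam :=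
  Real.one_le_exp (mul_nonneg (gammaHat_pos hσ hlam).le (sub_nonneg.2 hab))

lemma avg_le (hφ : IsJumpDensity φ) {u : L2 a b} {C : ℝ} (hC : 0 ≤ C)
    (h : ∀ᵐ x ∂volume.restrict (Ioo a b), u x ≤ C) (x : ℝ) : avg φ u x ≤ C := by
  have h1 : avg φ u x ≤ ∫ z, C * φ (x - z) := by
    refine integral_mono_ae (hφ.integrable_mul (integrable_zeroExt u) x)
      ((hφ.integrable.comp_sub_left x).const_mul _) ?_
    filter_upwards [(ae_restrict_iff' measurableSet_Ioo).1 h] with z hz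
    refine mul_le_mul_of_nonneg_right ?_ (hφ.nonneg _)
    by_cases hz' : z ∈ Ioo a b
    · simpa [zeroExt, hz'] using hz hz'
    · simpa [zeroExt, hz'] using hC
  rwa [integral_const_mul, hφ.integral_comp_sub, mul_one] at h1

/-- The second derivative at an interior local maximum is nonpositive. -/
lemma deriv_deriv_nonpos_of_isLocalMax {Z : ℝ → ℝ} {x : ℝ} (hZ : ContinuousAt Z x)
    (h : IsLocalMax Z x) : deriv (deriv Z) x ≤ 0 := by
  by_contra! hpos
  have hmin := isLocalMin_of_deriv_deriv_pos hpos h.deriv_eq_zero hZ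
  have hconst : Z =ᶠ[nhds x] fun _ => Z x := by
    filter_upwards [h, hmin] with y h1 h2
    exact le_antisymm h1 h2
  have h2 := hconst.deriv.deriv_eq
  simp at h2
  linarith

/-- The maximum principle, with the barrier `m (c₄ - exp (γ (x - a)))`, which is nonnegative on
`[a,b]` and vanishes at `b`. -/
lemma IsShiftedSolution.ae_le (hab : a < b) (hμ : 0 < μ) (hσ : 0 < σ) (hlam : 0 < lam)
    (ht : 0 ≤ t) (hφ : IsJumpDensity φ) {f v : L2 a b}
    (hv : IsShiftedSolution μ σ lam t φ f v) {F : ℝ → ℝ} (hF : ContinuousOn F (Icc a b))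
    (hfF : f =ᵐ[volume.restrict (Ioo a b)] F) {m : ℝ} (hm : 0 < m) (hFm : ∀ x ∈ Ioo a b, F x ≤ m) :
    ∀ᵐ x ∂volume.restrict (Ioo a b), v x ≤ c4 a b μ σ lam * m := by
  obtain ⟨U, hU2, hUa, hUb, hvU, heq⟩ := hv.exists_contDiff hab hσ hφ hF hfF
  have hγ := gammaHat_pos (b := b) (μ := μ) hσ hlam
  have hroot := gammaHat_root (b := b) (μ := μ) hσ hlam
  have hc4 : c4 a b μ σ lam = Real.exp (gammaHat b μ σ lam * (b - a)) := rfl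
  have hc41 := one_le_c4 (μ := μ) hab.le hσ hlam
  set γ := gammaHat b μ σ lam
  set K := c4 a b μ σ lam
  let Z : ℝ → ℝ := fun x => U x - m * (K - Real.exp (γ * (x - a)))
  have hUd : Differentiable ℝ U := hU2.differentiable (by simp)
  have hU'd : Differentiable ℝ (deriv U) := hU2.differentiable_deriv_two
  have hexp : ∀ x, HasDerivAt (fun x => Real.exp (γ * (x - a))) (γ * Real.exp (γ * (x - a))) x := by
    intro x
    have h1 : HasDerivAt (fun x => γ * (x - a)) γ x := by
      simpa using ((hasDerivAt_id x).sub_const a).const_mul γ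
    simpa [mul_comm] using h1.exp
  have hZ' : deriv Z = fun x => deriv U x + m * (γ * Real.exp (γ * (x - a))) := by
    funext x
    have := ((hUd x).hasDerivAt.sub (((hexp x).const_sub K).const_mul m)).deriv
    refine Eq.trans this ?_
    ring
  have hZ'' : deriv (deriv Z) = fun x => deriv (deriv U) x
      + m * (γ * (γ * Real.exp (γ * (x - a)))) := by
    funext x
    rw [hZ']
    exact ((hU'd x).hasDerivAt.add (((hexp x).const_mul γ).const_mul m)).deriv
  have hZc : Continuous Z := by
    have := hU2.continuous
    fun_prop
  have hone : ∀ x ∈ Icc a b, 1 ≤ Real.exp (γ * (x - a)) := fun x hx =>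
    Real.one_le_exp (mul_nonneg hγ.le (sub_nonneg.2 hx.1))
  have hleK : ∀ x ∈ Icc a b, Real.exp (γ * (x - a)) ≤ K := fun x hx => by
    rw [hc4]
    exact Real.exp_le_exp.2 (mul_le_mul_of_nonneg_left (by linarith [hx.2]) hγ.le)
  obtain ⟨x, hx, hmax⟩ := isCompact_Icc.exists_isMaxOn (nonempty_Icc.2 hab.le) hZc.continuousOn
  have hmax' : ∀ y ∈ Icc a b, Z y ≤ Z x := fun y hy => hmax hy
  suffices hZx : Z x ≤ 0 by
    filter_upwards [hvU, ae_restrict_mem measurableSet_Ioo] with y hy hy'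
    have h1 := hmax' y (Ioo_subset_Icc_self hy')
    have h2 : 0 < m * Real.exp (γ * (y - a)) := mul_pos hm (Real.exp_pos _)
    simp only [Z] at h1 hZx
    rw [hy]
    nlinarith
  -- a positive maximum lies in the interior, where the equation contradicts the barrier property
  by_contra! hpos
  have hxa : x ≠ a := by
    rintro rfl
    simp only [Z, hUa, sub_self, mul_zero, Real.exp_zero] at hpos
    nlinarith
  have hxb : x ≠ b := by
    rintro rfl
    simp only [Z, hUb, hc4, sub_self, mul_zero] at hpos
    exact lt_irrefl _ hpos
  have hxI : x ∈ Ioo a b := ⟨lt_of_le_of_ne hx.1 hxa.symm, lt_of_le_of_ne hx.2 hxb⟩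
  have hloc : IsLocalMax Z x := hmax.isLocalMax (Icc_mem_nhds hxI.1 hxI.2)
  have h1 := hloc.deriv_eq_zero
  have h2 := deriv_deriv_nonpos_of_isLocalMax hZc.continuousAt hloc
  rw [hZ'] at h1
  rw [hZ''] at h2
  have h3 := heq x hxI
  have h4 := hFm x hxI
  rw [opL] at h3
  have he1 := hone x hx
  have heK := hleK x hx
  have havg : avg φ v x ≤ Z x + m * (K - 1) := by
    refine avg_le hφ (add_nonneg hpos.le (mul_nonneg hm.le (sub_nonneg.2 hc41))) ?_ x
    filter_upwards [hvU, ae_restrict_mem measurableSet_Ioo] with y hy hy'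
    have h5 := hmax' y (Ioo_subset_Icc_self hy')
    have h6 := mul_le_mul_of_nonneg_left (hone y (Ioo_subset_Icc_self hy')) hm.le
    simp only [Z] at h5 ⊢
    rw [hy]
    linarith
  have hUx : U x = Z x + m * (K - Real.exp (γ * (x - a))) := by simp only [Z]; ring
  have hE : 0 ≤ m * (K - Real.exp (γ * (x - a))) := mul_nonneg hm.le (sub_nonneg.2 heK)
  set e := Real.exp (γ * (x - a))
  have ht' : 0 ≤ t * U x := mul_nonneg ht (by linarith)
  have hjump : lam * (avg φ v x - U x) ≤ lam * (m * (e - 1)) :=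
    mul_le_mul_of_nonneg_left (by rw [hUx]; linarith) hlam.le
  have hdrift : μ * x * deriv U x ≥ -(μ * b * γ * (m * e)) := by
    have h5 : deriv U x = -(m * (γ * e)) := by linarith
    have h6 : 0 ≤ μ * (m * (γ * e)) * (b - x) :=
      mul_nonneg (by positivity) (sub_nonneg.2 hx.2)
    rw [h5]
    linarith
  have hdiff : -(1 / 2) * σ ^ 2 * deriv (deriv U) x ≥ 1 / 2 * σ ^ 2 * γ ^ 2 * (m * e) := by
    have h5 : 0 ≤ 1 / 2 * σ ^ 2 * -(deriv (deriv U) x + m * (γ * (γ * e))) :=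
      mul_nonneg (by positivity) (by linarith)
    linarith
  have hsum : 1 / 2 * σ ^ 2 * γ ^ 2 * (m * e) - μ * b * γ * (m * e) = (lam + 1) * (m * e) := by
    rw [← hroot]; ring
  -- the left side of the equation is at least `(lam + 1) m e - lam m (e - 1) > m`
  have hme : m ≤ m * e := by nlinarith
  have hml : 0 < lam * m := mul_pos hlam hm
  linarith

/-- The sup-norm bound `|v| ≤ c₄ m`, from the maximum principle applied to `v` and `-v`. -/
lemma IsShiftedSolution.ae_abs_le (hab : a < b) (hμ : 0 < μ) (hσ : 0 < σ) (hlam : 0 < lam)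
    (ht : 0 ≤ t) (hφ : IsJumpDensity φ) {f v : L2 a b}
    (hv : IsShiftedSolution μ σ lam t φ f v) {F : ℝ → ℝ} (hF : ContinuousOn F (Icc a b))
    (hfF : f =ᵐ[volume.restrict (Ioo a b)] F) {m : ℝ} (hm : 0 < m)
    (hFm : ∀ x ∈ Ioo a b, |F x| ≤ m) :
    ∀ᵐ x ∂volume.restrict (Ioo a b), |v x| ≤ c4 a b μ σ lam * m := by
  have hneg : IsShiftedSolution μ σ lam t φ (-f) (-v) := by
    simpa using (isShiftedSolution_zero hab hφ).sub hab hφ hv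
  have h1 := hv.ae_le hab hμ hσ hlam ht hφ hF hfF hm fun x hx => (abs_le.1 (hFm x hx)).2
  have h2 := hneg.ae_le hab hμ hσ hlam ht hφ (F := fun x => -F x) hF.neg (by
    filter_upwards [hfF, Lp.coeFn_neg f] with x h1 h2
    rw [h2, Pi.neg_apply, h1]) hm fun x hx => neg_le.1 (abs_le.1 (hFm x hx)).1
  filter_upwards [h1, h2, Lp.coeFn_neg v] with x h1 h2 h3
  rw [h3, Pi.neg_apply] at h2
  exact abs_le.2 ⟨by linarith, h1⟩

/-! ### A priori bounds -/

lemma norm_one_pos (hab : a < b) : 0 < ‖one a b‖ := by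
  have h := norm_one_sq hab.le
  refine lt_of_le_of_ne (norm_nonneg _) fun h0 => ?_
  rw [← h0, zero_pow two_ne_zero] at h
  linarith

lemma c6_nonneg (hab : a < b) : 0 ≤ c6 a b μ σ lam :=
  mul_nonneg (div_nonneg (sub_nonneg.2 hab.le) Real.pi_pos.le) (Real.sqrt_nonneg _)

/-- Gårding's inequality; the jump part of the form is nonnegative. -/
lemma garding (hab : a < b) (hlam : 0 < lam) (hφ : IsJumpDensity φ) {v : L2 a b}
    (hv : MemH10 v) :
    1 / 2 * σ ^ 2 * ‖D v‖ ^ 2 - μ / 2 * ‖v‖ ^ 2 ≤ formA μ σ lam φ v v := by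
  have h1 : ⟪avgOp hφ v, v⟫_ℝ ≤ ‖v‖ ^ 2 := by
    refine (real_inner_le_norm _ _).trans ?_
    rw [sq]
    exact mul_le_mul_of_nonneg_right (norm_avgOp_le hφ v) (norm_nonneg _)
  rw [formA_eq hφ, inner_mulX_D_self hab hv, real_inner_self_eq_norm_sq, real_inner_self_eq_norm_sq]
  nlinarith

/-- Both the shifted problem and its adjoint are solvable for all right-hand sides. -/
def IsSolvable (a b μ σ lam t : ℝ) (φ : ℝ → ℝ) : Prop :=
  (∀ f : L2 a b, ∃ v, IsShiftedSolution μ σ lam t φ f v) ∧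
    ∀ g : L2 a b, ∃ w, IsShiftedAdjointSolution μ σ lam t φ g w

/-- Testing each problem with the solution of the other one. -/
lemma inner_eq_of_solutions {f v g w : L2 a b} (hv : IsShiftedSolution μ σ lam t φ f v)
    (hw : IsShiftedAdjointSolution μ σ lam t φ g w) : ⟪v, g⟫_ℝ = ⟪f, w⟫_ℝ := by
  rw [← hv.2 w hw.1, hw.2 v hv.1]

/-- Duality with the sup-norm bound for the right-hand side `w` itself. -/
lemma IsShiftedAdjointSolution.norm_sq_le (hab : a < b) (hμ : 0 < μ) (hσ : 0 < σ)
    (hlam : 0 < lam) (ht : 0 ≤ t) (hφ : IsJumpDensity φ) (hs : IsSolvable a b μ σ lam t φ)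
    {g w : L2 a b} (hw : IsShiftedAdjointSolution μ σ lam t φ g w) :
    ‖w‖ ^ 2 ≤ c5 a b μ σ lam * ‖D w‖ * ‖g‖ := by
  obtain ⟨hb, hwp⟩ := hw.1.prim_D_and_eq hab
  have hc5 : c5 a b μ σ lam = ‖one a b‖ ^ 2 * c4 a b μ σ lam := by rw [norm_one_sq hab.le, c5]
  rcases eq_or_ne (D w) 0 with h0 | h0
  · rw [h0, map_zero] at hwp
    rw [h0, norm_zero, hwp]
    simp
  have hm : 0 < ‖one a b‖ * ‖D w‖ := mul_pos (norm_one_pos hab) (norm_pos_iff.2 h0)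
  obtain ⟨v, hv⟩ := hs.1 w
  have hwae : w =ᵐ[volume.restrict (Ioo a b)] prim (D w) := by
    conv_lhs => rw [hwp]
    exact coe_volt _
  have hsup := norm_le_of_ae_bound (hv.ae_abs_le hab hμ hσ hlam ht hφ
    (continuous_prim (D w)).continuousOn hwae hm fun x _ => abs_prim_le (D w) x)
  have h1 := inner_eq_of_solutions hv hw
  rw [real_inner_self_eq_norm_sq] at h1
  rw [← h1, hc5]
  refine (real_inner_le_norm _ _).trans ?_
  refine (mul_le_mul_of_nonneg_right hsup (norm_nonneg _)).trans (le_of_eq ?_)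
  ring

/-- The energy estimate, closed by duality instead of coercivity. -/
lemma IsShiftedAdjointSolution.norm_le (hab : a < b) (hμ : 0 < μ) (hσ : 0 < σ)
    (hlam : 0 < lam) (ht : 0 ≤ t) (hφ : IsJumpDensity φ) (hs : IsSolvable a b μ σ lam t φ)
    {g w : L2 a b} (hw : IsShiftedAdjointSolution μ σ lam t φ g w) :
    ‖w‖ ≤ c6 a b μ σ lam * ‖g‖ := by
  have h1 := hw.norm_sq_le hab hμ hσ hlam ht hφ hs
  have h2 := garding (μ := μ) (σ := σ) hab hlam hφ hw.1
  have h3 := hw.2 w hw.1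
  rw [real_inner_self_eq_norm_sq] at h3
  have h4 := real_inner_le_norm w g
  have hc2 : 0 ≤ c2 a b := div_nonneg (sub_nonneg.2 hab.le) Real.pi_pos.le
  set c := c5 a b μ σ lam
  have h5 : 1 / 2 * σ ^ 2 * ‖D w‖ ^ 2 ≤ μ / 2 * ‖w‖ ^ 2 + ‖w‖ * ‖g‖ := by
    have := mul_nonneg ht (sq_nonneg ‖w‖)
    linarith
  have h6 : ‖w‖ * ‖g‖ ≤ μ / 2 * ‖w‖ ^ 2 + ‖g‖ ^ 2 / (2 * μ) := by
    have : 0 ≤ (μ * ‖w‖ - ‖g‖) ^ 2 / (2 * μ) := by positivity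
    have e : (μ * ‖w‖ - ‖g‖) ^ 2 / (2 * μ)
        = μ / 2 * ‖w‖ ^ 2 + ‖g‖ ^ 2 / (2 * μ) - ‖w‖ * ‖g‖ := by
      field_simp; ring
    linarith
  have h7 : μ * (c * ‖D w‖ * ‖g‖) ≤ 1 / 4 * σ ^ 2 * ‖D w‖ ^ 2 + μ ^ 2 * c ^ 2 * ‖g‖ ^ 2 / σ ^ 2 := by
    have : 0 ≤ (σ * ‖D w‖ / 2 - μ * c * ‖g‖ / σ) ^ 2 := sq_nonneg _
    have e : (σ * ‖D w‖ / 2 - μ * c * ‖g‖ / σ) ^ 2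
        = 1 / 4 * σ ^ 2 * ‖D w‖ ^ 2 + μ ^ 2 * c ^ 2 * ‖g‖ ^ 2 / σ ^ 2 - μ * (c * ‖D w‖ * ‖g‖) := by
      field_simp; ring
    linarith
  have h8 : ‖D w‖ ^ 2 ≤ (2 / (σ ^ 2 * μ) + 4 * μ ^ 2 / σ ^ 4 * c ^ 2) * ‖g‖ ^ 2 := by
    have h9 : 1 / 4 * σ ^ 2 * ‖D w‖ ^ 2 ≤ μ ^ 2 * c ^ 2 * ‖g‖ ^ 2 / σ ^ 2 + ‖g‖ ^ 2 / (2 * μ) := by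
      have := mul_le_mul_of_nonneg_left h1 hμ.le
      linarith
    have h10 := mul_le_mul_of_nonneg_left h9 (by positivity : 0 ≤ 4 / σ ^ 2)
    have e1 : 4 / σ ^ 2 * (1 / 4 * σ ^ 2 * ‖D w‖ ^ 2) = ‖D w‖ ^ 2 := by field_simp
    have e2 : 4 / σ ^ 2 * (μ ^ 2 * c ^ 2 * ‖g‖ ^ 2 / σ ^ 2 + ‖g‖ ^ 2 / (2 * μ))
        = (2 / (σ ^ 2 * μ) + 4 * μ ^ 2 / σ ^ 4 * c ^ 2) * ‖g‖ ^ 2 := by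
      field_simp; ring
    rwa [e1, e2] at h10
  have h9 : ‖D w‖ ≤ √(2 / (σ ^ 2 * μ) + 4 * μ ^ 2 / σ ^ 4 * c ^ 2) * ‖g‖ := by
    refine le_of_sq_le_sq ?_ (by positivity)
    rwa [mul_pow, Real.sq_sqrt (by positivity)]
  calc ‖w‖ ≤ c2 a b * ‖D w‖ := norm_le_c2_mul hab hw.1
    _ ≤ c2 a b * (√(2 / (σ ^ 2 * μ) + 4 * μ ^ 2 / σ ^ 4 * c ^ 2) * ‖g‖) :=
        mul_le_mul_of_nonneg_left h9 hc2
    _ = c6 a b μ σ lam * ‖g‖ := by rw [c6]; ring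

lemma IsShiftedSolution.norm_le (hab : a < b) (hμ : 0 < μ) (hσ : 0 < σ)
    (hlam : 0 < lam) (ht : 0 ≤ t) (hφ : IsJumpDensity φ) (hs : IsSolvable a b μ σ lam t φ)
    {f v : L2 a b} (hv : IsShiftedSolution μ σ lam t φ f v) :
    ‖v‖ ≤ c6 a b μ σ lam * ‖f‖ := by
  obtain ⟨w, hw⟩ := hs.2 v
  have h1 := inner_eq_of_solutions hv hw
  have h2 := hw.norm_le hab hμ hσ hlam ht hφ hs
  rw [real_inner_self_eq_norm_sq] at h1
  have h3 : ‖v‖ ^ 2 ≤ ‖f‖ * (c6 a b μ σ lam * ‖v‖) := by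
    rw [h1]
    exact (real_inner_le_norm _ _).trans (mul_le_mul_of_nonneg_left h2 (norm_nonneg _))
  rcases (norm_nonneg v).eq_or_lt with h0 | h0
  · rw [← h0] at h2 ⊢
    exact mul_nonneg (c6_nonneg hab) (norm_nonneg _)
  · refine le_of_mul_le_mul_right ?_ h0
    linarith

/-! ### Solvability by the method of continuity -/

lemma IsSolvable.solution_unique (hs : IsSolvable a b μ σ lam t φ) (hab : a < b)
    (hφ : IsJumpDensity φ) {f v v' : L2 a b} (hv : IsShiftedSolution μ σ lam t φ f v)
    (hv' : IsShiftedSolution μ σ lam t φ f v') : v = v' := by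
  obtain ⟨w, hw⟩ := hs.2 (v - v')
  have h := inner_eq_of_solutions (hv.sub hab hφ hv') hw
  rw [sub_self, inner_zero_left] at h
  exact sub_eq_zero.1 (inner_self_eq_zero.1 h)

lemma IsSolvable.adjointSolution_unique (hs : IsSolvable a b μ σ lam t φ) (hab : a < b)
    (hφ : IsJumpDensity φ) {g w w' : L2 a b} (hw : IsShiftedAdjointSolution μ σ lam t φ g w)
    (hw' : IsShiftedAdjointSolution μ σ lam t φ g w') : w = w' := by
  obtain ⟨v, hv⟩ := hs.1 (w - w')
  have h := inner_eq_of_solutions hv (hw.sub hab hφ hw')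
  rw [sub_self, inner_zero_right] at h
  exact sub_eq_zero.1 (inner_self_eq_zero.1 h.symm)

/-- The fixed point argument behind the method of continuity: if `R` has Lipschitz constant `C`
and `s C < 1`, then `v = R (f + s v)` is solvable. -/
lemma exists_eq_apply_add_smul {E : Type*} [NormedAddCommGroup E] [NormedSpace ℝ E]
    [CompleteSpace E] {R : E → E} {C s : ℝ} (hC : 0 ≤ C) (hs : 0 ≤ s) (hsC : s * C < 1)
    (hR : ∀ f g, ‖R f - R g‖ ≤ C * ‖f - g‖) (f : E) : ∃ v, R (f + s • v) = v := by
  have hcon : ContractingWith (s * C).toNNReal fun v => R (f + s • v) := by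
    refine ⟨by rwa [← NNReal.coe_lt_coe, Real.coe_toNNReal _ (mul_nonneg hs hC)], ?_⟩
    refine LipschitzWith.of_dist_le_mul fun v w => ?_
    rw [Real.coe_toNNReal _ (mul_nonneg hs hC), dist_eq_norm, dist_eq_norm]
    refine (hR _ _).trans (le_of_eq ?_)
    rw [add_sub_add_left_eq_sub, ← smul_sub, norm_smul, Real.norm_of_nonneg hs]
    ring
  exact ⟨_, hcon.fixedPoint_isFixedPt⟩

/-- One step of the method of continuity. -/
lemma IsSolvable.sub (hab : a < b) (hμ : 0 < μ) (hσ : 0 < σ) (hlam : 0 < lam) (ht : 0 ≤ t)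
    (hφ : IsJumpDensity φ) (hs : IsSolvable a b μ σ lam t φ) {s : ℝ} (hs0 : 0 ≤ s)
    (hsc : s * c6 a b μ σ lam < 1) : IsSolvable a b μ σ lam (t - s) φ := by
  constructor
  · intro f
    choose R hR using hs.1
    obtain ⟨v, hv⟩ := exists_eq_apply_add_smul (c6_nonneg hab) hs0 hsc (R := R)
      (fun f g => ((hR f).sub hab hφ (hR g)).norm_le hab hμ hσ hlam ht hφ hs) f
    have h := hR (f + s • v)
    rw [hv] at h
    refine ⟨v, h.1, fun ψ hψ => ?_⟩
    have h1 := h.2 ψ hψ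
    rw [inner_add_left, real_inner_smul_left] at h1
    linarith
  · intro g
    choose R hR using hs.2
    obtain ⟨w, hw⟩ := exists_eq_apply_add_smul (c6_nonneg hab) hs0 hsc (R := R)
      (fun f g => ((hR f).sub hab hφ (hR g)).norm_le hab hμ hσ hlam ht hφ hs) g
    have h := hR (g + s • w)
    rw [hw] at h
    refine ⟨w, h.1, fun ψ hψ => ?_⟩
    have h1 := h.2 ψ hψ
    rw [inner_add_right, real_inner_smul_right] at h1
    linarith

lemma IsCoercive.exists_forall_eq {X : Type*} [NormedAddCommGroup X] [InnerProductSpace ℝ X]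
    [CompleteSpace X] {B : X →L[ℝ] X →L[ℝ] ℝ} (hB : IsCoercive B) (ℓ : X →L[ℝ] ℝ) :
    ∃ p, ∀ q, B p q = ℓ q := by
  refine ⟨hB.continuousLinearEquivOfBilin.symm ((InnerProductSpace.toDual ℝ X).symm ℓ),
    fun q => ?_⟩
  rw [← hB.continuousLinearEquivOfBilin_apply, ContinuousLinearEquiv.apply_symm_apply,
    InnerProductSpace.toDual_symm_apply]

/-- For a large shift the form is coercive, and the theorem of Lax and Milgram applies on the
space of weak derivatives, the functions with vanishing integral. -/
lemma isSolvable_self (hab : a < b) (hμ : 0 < μ) (hσ : 0 < σ) (hlam : 0 < lam)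
    (hφ : IsJumpDensity φ) : IsSolvable a b μ σ lam μ φ := by
  let X : Submodule ℝ (L2 a b) := (innerSL ℝ (one a b)).ker
  have hX : ∀ p : L2 a b, p ∈ X ↔ prim p b = 0 := fun p => by
    rw [← inner_one_eq_prim hab.le]
    exact LinearMap.mem_ker
  have : CompleteSpace X := ContinuousLinearMap.completeSpace_ker (innerSL ℝ (one a b))
  let N : L2 a b →L[ℝ] L2 a b := (1 / 2 * σ ^ 2) • ContinuousLinearMap.id ℝ (L2 a b)
    + (ContinuousLinearMap.adjoint volt).comp
      (μ • mulX - lam • ((avgOp hφ).comp volt - volt) + μ • volt)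
  let B : X →L[ℝ] X →L[ℝ] ℝ := (innerSL ℝ).bilinearComp (N.comp X.subtypeL) X.subtypeL
  have hB : ∀ p q : X, B p q = formA μ σ lam φ (volt (p : L2 a b)) (volt (q : L2 a b))
      + μ * ⟪volt (p : L2 a b), volt (q : L2 a b)⟫_ℝ := by
    intro p q
    have h : B p q = ⟪N p, (q : L2 a b)⟫_ℝ := rfl
    rw [h, formA_eq hφ, D_volt hab.le, D_volt hab.le]
    simp only [N, add_apply, smul_apply, sub_apply, ContinuousLinearMap.comp_apply,
      ContinuousLinearMap.id_apply, inner_add_left, ContinuousLinearMap.adjoint_inner_left, inner_sub_left,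
      real_inner_smul_left]
    ring
  have hcoer : ∀ p : X, 1 / 2 * σ ^ 2 * ‖p‖ * ‖p‖ ≤ B p p := by
    intro p
    have h1 := garding (μ := μ) (σ := σ) hab hlam hφ (memH10_volt hab.le ((hX p).1 p.2))
    rw [D_volt hab.le] at h1
    have h2 : ‖(p : L2 a b)‖ = ‖p‖ := rfl
    rw [h2] at h1
    rw [hB, real_inner_self_eq_norm_sq]
    have h3 := mul_nonneg hμ.le (sq_nonneg ‖volt (p : L2 a b)‖)
    linarith
  have hpos : 0 < 1 / 2 * σ ^ 2 := by positivity
  have hcB : IsCoercive B := ⟨_, hpos, hcoer⟩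
  have hcB' : IsCoercive B.flip := ⟨_, hpos, hcoer⟩
  constructor
  · intro f
    obtain ⟨p, hp⟩ := hcB.exists_forall_eq (((innerSL ℝ f).comp volt).comp X.subtypeL)
    refine ⟨volt (p : L2 a b), memH10_volt hab.le ((hX p).1 p.2), fun ψ hψ => ?_⟩
    obtain ⟨h1, h2⟩ := hψ.prim_D_and_eq hab
    have h3 := hp ⟨D ψ, (hX _).2 h1⟩
    rw [hB] at h3
    rw [h2]
    exact h3
  · intro g
    obtain ⟨p, hp⟩ := hcB'.exists_forall_eq (((innerSL ℝ g).comp volt).comp X.subtypeL)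
    refine ⟨volt (p : L2 a b), memH10_volt hab.le ((hX p).1 p.2), fun ψ hψ => ?_⟩
    obtain ⟨h1, h2⟩ := hψ.prim_D_and_eq hab
    have h3 := hp ⟨D ψ, (hX _).2 h1⟩
    rw [ContinuousLinearMap.flip_apply, hB] at h3
    rw [h2, real_inner_comm g]
    exact h3

/-- Solvability of the original problem: `n` steps of length `μ / n` lead from the shift `μ` to `0`. -/
lemma isSolvable_zero (hab : a < b) (hμ : 0 < μ) (hσ : 0 < σ) (hlam : 0 < lam)
    (hφ : IsJumpDensity φ) : IsSolvable a b μ σ lam 0 φ := by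
  obtain ⟨n, hn⟩ := exists_nat_gt (μ * c6 a b μ σ lam)
  have hn0 : (0 : ℝ) < n := (mul_nonneg hμ.le (c6_nonneg hab)).trans_lt hn
  have hstep : ∀ k : ℕ, k ≤ n → IsSolvable a b μ σ lam (μ - k * (μ / n)) φ := by
    intro k
    induction k with
    | zero => simpa using isSolvable_self hab hμ hσ hlam hφ
    | succ k ih =>
      intro hk
      have hkn : (k : ℝ) ≤ n := by exact_mod_cast (Nat.le_succ k).trans hk
      have h0 : 0 ≤ μ - k * (μ / n) := by
        rw [mul_div_assoc', sub_nonneg, div_le_iff₀ hn0, mul_comm]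
        exact mul_le_mul_of_nonneg_left hkn hμ.le
      have h := (ih ((Nat.le_succ k).trans hk)).sub hab hμ hσ hlam h0 hφ (s := μ / n)
        (div_nonneg hμ.le hn0.le) (by rwa [div_mul_eq_mul_div, div_lt_one hn0])
      convert h using 1
      push_cast
      ring
  have h := hstep n le_rfl
  rwa [mul_div_cancel₀ _ hn0.ne', sub_self] at h

/-! ### The second derivative -/

/-- The `H^2` bound, once the second derivative has been estimated through the equation; the first
order term is absorbed by `‖Dv‖² = -(v, D²v)`. -/
lemma norm_D_D_le (hab : a < b) (hμ : 0 < μ) (hσ : 0 < σ) {f v : L2 a b} (hv : MemH10 v)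
    (hv2 : MemH1 (D v)) (hb : ‖v‖ ≤ c6 a b μ σ lam * ‖f‖) (hlam : 0 < lam)
    (h : ‖D (D v)‖ ≤ 2 / σ ^ 2 * (μ * (max |a| |b| * ‖D v‖) + (2 * lam + μ) * ‖v‖ + ‖f‖)) :
    ‖D (D v)‖ ≤ c3 a b μ σ lam * ‖f‖ := by
  have h1 : ‖D v‖ ^ 2 ≤ ‖v‖ * ‖D (D v)‖ := by
    have h2 := inner_D_of_memH1 hab hv2 hv
    rw [real_inner_self_eq_norm_sq] at h2
    have h3 := neg_le_of_abs_le (abs_real_inner_le_norm (D (D v)) v)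
    linarith
  set M := max |a| |b|
  have hM : 0 ≤ M := (abs_nonneg a).trans (le_max_left _ _)
  set y := ‖D (D v)‖
  have hy : 0 ≤ y := norm_nonneg _
  have hn : 0 ≤ ‖v‖ := norm_nonneg _
  have h2 : 2 / σ ^ 2 * (μ * (M * ‖D v‖))
      ≤ 1 / 2 * y + 1 / 2 * (2 / σ ^ 2 * (μ * M)) ^ 2 * ‖v‖ := by
    refine le_of_sq_le_sq ?_ (by positivity)
    have h3 := mul_le_mul_of_nonneg_left h1 (sq_nonneg (2 / σ ^ 2 * (μ * M)))
    have h4 := sq_nonneg (1 / 2 * y - 1 / 2 * (2 / σ ^ 2 * (μ * M)) ^ 2 * ‖v‖)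
    nlinarith
  have h3 : y ≤ c7 σ * ‖f‖ + c8 a b μ σ lam * ‖v‖ := by
    have e : c7 σ * ‖f‖ + c8 a b μ σ lam * ‖v‖
        = 2 * (2 / σ ^ 2 * ‖f‖ + 2 / σ ^ 2 * ((2 * lam + μ) * ‖v‖)
          + 1 / 2 * (2 / σ ^ 2 * (μ * M)) ^ 2 * ‖v‖) := by
      rw [c7, c8]
      field_simp
      ring
    rw [e]
    linarith
  have hc8 : 0 ≤ c8 a b μ σ lam := by rw [c8]; positivity
  calc y ≤ c7 σ * ‖f‖ + c8 a b μ σ lam * ‖v‖ := h3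
    _ ≤ c7 σ * ‖f‖ + c8 a b μ σ lam * (c6 a b μ σ lam * ‖f‖) := by gcongr
    _ = c3 a b μ σ lam * ‖f‖ := by rw [c3]; ring

lemma isShiftedSolution_iff {f v : L2 a b} :
    IsShiftedSolution μ σ lam 0 φ f v ↔ IsWeakSolution μ σ lam φ f v := by
  simp only [IsShiftedSolution, IsWeakSolution, zero_mul, add_zero, inner_eq_integral]

lemma isShiftedAdjointSolution_iff {g w : L2 a b} :
    IsShiftedAdjointSolution μ σ lam 0 φ g w ↔ IsAdjointWeakSolution μ σ lam φ g w := by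
  simp only [IsShiftedAdjointSolution, IsAdjointWeakSolution, zero_mul, add_zero,
    inner_eq_integral]

lemma norm_jump_le (hφ : IsJumpDensity φ) (hlam : 0 < lam) (v : L2 a b) :
    ‖lam • (avgOp hφ v - v)‖ ≤ 2 * lam * ‖v‖ := by
  rw [norm_smul, Real.norm_of_nonneg hlam.le]
  nlinarith [norm_sub_le (avgOp hφ v) v, norm_avgOp_le hφ v]

lemma norm_drift_le (hμ : 0 < μ) (v : L2 a b) :
    ‖μ • mulX v‖ ≤ μ * (max |a| |b| * ‖v‖) := by
  rw [norm_smul, Real.norm_of_nonneg hμ.le]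
  exact mul_le_mul_of_nonneg_left (norm_mulX_le v) hμ.le

/-- `H^2` regularity of the weak solution. -/
lemma IsShiftedSolution.memH2_and_norm_le (hab : a < b) (hμ : 0 < μ) (hσ : 0 < σ)
    (hlam : 0 < lam) (hφ : IsJumpDensity φ) {f v : L2 a b}
    (hv : IsShiftedSolution μ σ lam 0 φ f v) :
    MemH2 v ∧ ‖D (D v)‖ ≤ c3 a b μ σ lam * ‖f‖ := by
  have hd := hv.isWeakDeriv_D hab hσ hφ
  refine ⟨⟨hv.1.1, ⟨_, hd⟩⟩, norm_D_D_le hab hμ hσ hv.1 ⟨_, hd⟩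
    (hv.norm_le hab hμ hσ hlam le_rfl hφ (isSolvable_zero hab hμ hσ hlam hφ)) hlam ?_⟩
  rw [D_eq hd, norm_smul, Real.norm_of_nonneg (by positivity), zero_smul, add_zero]
  refine mul_le_mul_of_nonneg_left ?_ (by positivity)
  have h1 := norm_sub_le (μ • mulX (D v) - lam • (avgOp hφ v - v)) f
  have h2 := norm_sub_le (μ • mulX (D v)) (lam • (avgOp hφ v - v))
  have h3 := norm_jump_le hφ hlam v
  have h4 := norm_drift_le hμ (D v)
  have h5 := mul_nonneg hμ.le (norm_nonneg v)
  linarith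

/-- `H^2` regularity of the adjoint solution. -/
lemma IsShiftedAdjointSolution.memH2_and_norm_le (hab : a < b) (hμ : 0 < μ) (hσ : 0 < σ)
    (hlam : 0 < lam) (hφ : IsJumpDensity φ) {g w : L2 a b}
    (hw : IsShiftedAdjointSolution μ σ lam 0 φ g w) :
    MemH2 w ∧ ‖D (D w)‖ ≤ c3 a b μ σ lam * ‖g‖ := by
  have hd := hw.isWeakDeriv_D hab hσ hφ
  refine ⟨⟨hw.1.1, ⟨_, hd⟩⟩, norm_D_D_le hab hμ hσ hw.1 ⟨_, hd⟩
    (hw.norm_le hab hμ hσ hlam le_rfl hφ (isSolvable_zero hab hμ hσ hlam hφ)) hlam ?_⟩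
  rw [D_eq hd, norm_smul, Real.norm_of_nonneg (by positivity), zero_smul, add_zero]
  refine mul_le_mul_of_nonneg_left ?_ (by positivity)
  have h1 := norm_sub_le (-(μ • mulX (D w)) - μ • w - lam • (avgOp hφ w - w)) g
  have h2 := norm_sub_le (-(μ • mulX (D w)) - μ • w) (lam • (avgOp hφ w - w))
  have h3 := norm_jump_le hφ hlam w
  have h4 := norm_drift_le hμ (D w)
  have h5 := norm_sub_le (-(μ • mulX (D w))) (μ • w)
  rw [norm_neg, norm_smul μ w, Real.norm_of_nonneg hμ.le] at h5
  linarith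

/-- A solution with continuous right-hand side, extended by zero, is a classical solution. -/
lemma IsShiftedSolution.exists_isClassicalSolution (hab : a < b) (hσ : 0 < σ)
    (hφ : IsJumpDensity φ) {f v : L2 a b} (hv : IsShiftedSolution μ σ lam 0 φ f v) {F : ℝ → ℝ}
    (hF : ContinuousOn F (Icc a b)) (hfF : f =ᵐ[volume.restrict (Ioo a b)] F) :
    ∃ V : ℝ → ℝ, V =ᵐ[volume.restrict (Ioo a b)] v ∧ IsClassicalSolution a b μ σ lam φ F V := by
  obtain ⟨U, hU2, hUa, hUb, hvU, heq⟩ := hv.exists_contDiff hab hσ hφ hF hfF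
  have hV : (Ioo a b).indicator U =ᵐ[volume.restrict (Ioo a b)] v :=
    (indicator_ae_eq_restrict measurableSet_Ioo).trans hvU.symm
  refine ⟨(Ioo a b).indicator U, hV, ?_, fun x hx => ?_, fun x hx => indicator_of_notMem hx _⟩
  · refine hU2.contDiffOn.congr fun x hx => ?_
    by_cases hx' : x ∈ Ioo a b
    · exact indicator_of_mem hx' _
    · rw [indicator_of_notMem hx']
      rcases eq_endpoints_or_mem_Ioo_of_mem_Icc hx with h | h | h
      · rw [h, hUa]
      · rw [h, hUb]
      · exact absurd h hx'
  · have hloc : (Ioo a b).indicator U =ᶠ[nhds x] U := by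
      filter_upwards [isOpen_Ioo.mem_nhds hx] with y hy
      exact indicator_of_mem hy _
    have hVv : (Ioo a b).indicator U =ᵐ[volume] zeroExt v :=
      ae_eq_of_restrict (hV.trans (zeroExt_ae_eq v).symm) (fun x hx => indicator_of_notMem hx _)
        fun x hx => zeroExt_of_notMem v hx
    rw [opI_eq hφ lam v hVv, opL, hloc.deriv.deriv_eq, hloc.deriv_eq, hloc.eq_of_nhds, ← heq x hx,
      opL]
    ring

end OUJump

theorem theorem2 (a b μ σ lam : ℝ) (hab : a < b) (hμ : 0 < μ) (hσ : 0 < σ) (hlam : 0 < lam)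
    (φ : ℝ → ℝ) (hφ : IsJumpDensity φ) :
    -- existence and uniqueness of the weak solution
    (∀ f : L2 a b, ∃! v : L2 a b, IsWeakSolution μ σ lam φ f v) ∧
    -- regularity and the bound on the second derivative
    (∀ f v : L2 a b, IsWeakSolution μ σ lam φ f v →
      MemH2 v ∧ ‖D (D v)‖ ≤ c3 a b μ σ lam * ‖f‖) ∧
    -- for f(x) = -μ x the weak solution is classical
    (∀ f v : L2 a b, f =ᵐ[volume.restrict (Ioo a b)] (fun x : ℝ => -μ * x) →
      IsWeakSolution μ σ lam φ f v →
      ∃ V : ℝ → ℝ, V =ᵐ[volume.restrict (Ioo a b)] v ∧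
        IsClassicalSolution a b μ σ lam φ (fun x : ℝ => -μ * x) V) ∧
    -- the adjoint problem
    (∀ g : L2 a b, ∃! w : L2 a b, IsAdjointWeakSolution μ σ lam φ g w) ∧
    (∀ g w : L2 a b, IsAdjointWeakSolution μ σ lam φ g w →
      MemH2 w ∧ ‖D (D w)‖ ≤ c3 a b μ σ lam * ‖g‖) := by
  have hs := isSolvable_zero hab hμ hσ hlam hφ
  simp only [← isShiftedSolution_iff, ← isShiftedAdjointSolution_iff]
  refine ⟨fun f => ?_, fun f v hv => hv.memH2_and_norm_le hab hμ hσ hlam hφ,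
    fun f v hf hv => hv.exists_isClassicalSolution hab hσ hφ
      (continuous_const.mul continuous_id).continuousOn hf,
    fun g => ?_, fun g w hw => hw.memH2_and_norm_le hab hμ hσ hlam hφ⟩
  · obtain ⟨v, hv⟩ := hs.1 f
    exact ⟨v, hv, fun v' hv' => hs.solution_unique hab hφ hv' hv⟩
  · obtain ⟨w, hw⟩ := hs.2 g
    exact ⟨w, hw, fun w' hw' => hs.adjointSolution_unique hab hφ hw' hw⟩
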